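/- For $h,N\in\mathbb{N}$ let $T(h,N)$ be the number of $(x_1,x_2,x_3,x_4)\in\mathbb{Z}^4\cap[-N,N]^4$ with $x_1x_4-x_2x_3=h$. Then for every $\varepsilon>0$ there is a constant $C_\varepsilon>0$, depending only on $\varepsilon$, such that for all positive integers $h,N$ with $1\le h\le 2N^2$, writing $\Delta=h-N^2$, one has $$\left|\,T(h,N)-\left(\frac{8}{\zeta(2)}-4\right)\Bigg(\sum_{d\mid h}\frac1d\Bigg)N^2\right|\le C_\varepsilon\left(N^{1+\varepsilon}+N^{\varepsilon}|\Delta|\right),$$ where $d$ runs over the positive divisors of $h$ and $\zeta$ is the Riemann zeta function. -/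

import Mathlib

/-- `solutionCount h N`, written `T(h, N)` in text, is the number of integer points
`x = (x₁, x₂, x₃, x₄)` in the box `[-N, N]⁴` with `x₁ x₄ - x₂ x₃ = h`
(in the code the coordinates are indexed from `0`). -/
noncomputable def solutionCount (h N : ℕ) : ℕ :=
  ((Fintype.piFinset fun _ : Fin 4 => Finset.Icc (-(N : ℤ)) (N : ℤ)).filter
    fun x => x 0 * x 3 - x 1 * x 2 = (h : ℤ)).card

/-!
Write `Δ = h - N²`. Up to the sign symmetries of the box, and up to the `O(N τ(h))` solutions with
`x₁ x₂ = 0`, the count is four times the number of solutions of `a b + c d = h` with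
`1 ≤ a, c ≤ N` and `|b|, |d| ≤ N` (`solutionCount_eq`). Substituting `b = N - x`, `d = N - y` turns
the equation into `a x + c y + h = N (a + c)`. Here the upper bounds on `x` and `y` may be dropped:
a solution with `x > N` has `0 < a (x - N) ≤ N² - h`, so the divisor bound shows that at most
`O(|Δ| N^ε)` solutions are added (`sum_lineExcess_le`).

Group the pairs `(a, c)` by `g = gcd(a, c)`, a divisor of `h`, and divide the equation by `g`,
which replaces `h` by `h / g` (`sum_lineCount_eq_sum_divisors`). For coprime `a, c` the number of
`x, y ≥ 0` on the line is `m / (a c) + (1 - 2 y₀ / a) / 2 + (1 - 2 x₀ / c) / 2` with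
`m = N (a + c) - h ≥ 0`, where `x₀` and `y₀` are least nonnegative residues of coordinates of solutions
(`lineCount_eq`). What makes `h` near `N²` special is that `m ≥ 0` (with `h / g` for `h`) is then
nearly the condition `a + c > X` with `X = ⌊N / g⌋`, so that for fixed `a` the variable `c` runs
through a complete residue system modulo `a` (`sum_coprimePairs_corner`). This has two
consequences.

* The fractional parts cancel: after Möbius inversion the sums of `1 - 2 y₀ / a` over `c` are
  complete, and the distribution relation of the sawtooth bounds them by `τ(a) gcd(h, a)`
  (`abs_sum_units_sawtooth_le`), which is `O(N^ε)` on average over `a`.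
* The main term is explicit: the Farey identity `∑ 1 / (a c) = 1` over coprime `a, c ≤ X` with
  `a + c > X` gives `∑ (a + c - X)⁺ / (a c) = 2 ∑_{a ≤ X} φ(a) / a - X` (`sum_coprimePairs_max`),
  and `∑_{a ≤ X} φ(a) / a = X / ζ(2) + O(log X)`.

Summing over `g ∣ h` produces `(2 / ζ(2) - 1) σ₋₁(h) N²`. All errors are bounded by
`K³ H² (N + |Δ|)` up to a constant, where `K` bounds the divisor function up to `2 N²` and `H` is
the `N`-th harmonic number (`abs_solutionCount_sub_main_le`).
-/

/-! ### The divisor bound -/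

theorem add_one_le_mul_rpow {δ : ℝ} (hδ : 0 < δ) {p : ℕ} (hp : 2 ≤ p) (e : ℕ) :
    (e : ℝ) + 1 ≤ (1 + 1 / (δ * Real.log 2)) * (p : ℝ) ^ (δ * e) := by
  have hl : 0 < Real.log 2 := Real.log_pos (by norm_num)
  have h1 : 1 + δ * e * Real.log 2 ≤ (p : ℝ) ^ (δ * e) := by
    have h2 : (2 : ℝ) ^ (δ * e) ≤ (p : ℝ) ^ (δ * e) :=
      Real.rpow_le_rpow (by norm_num) (by exact_mod_cast hp) (by positivity)
    have h3 : (2 : ℝ) ^ (δ * e) = Real.exp (Real.log 2 * (δ * e)) :=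
      Real.rpow_def_of_pos (by norm_num) _
    have := Real.add_one_le_exp (Real.log 2 * (δ * e))
    rw [h3] at h2
    linarith
  have h4 : (e : ℝ) + 1 ≤ (1 + 1 / (δ * Real.log 2)) * (1 + δ * e * Real.log 2) := by
    have : (1 + 1 / (δ * Real.log 2)) * (1 + δ * e * Real.log 2)
        = 1 + e + (δ * e * Real.log 2 + 1 / (δ * Real.log 2)) := by
      field_simp
      ring
    rw [this]
    have : 0 ≤ δ * e * Real.log 2 + 1 / (δ * Real.log 2) := by positivity
    linarith
  exact h4.trans (mul_le_mul_of_nonneg_left h1 (by positivity))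

theorem add_one_le_rpow {δ : ℝ} {p : ℕ} (hp : (2 : ℝ) ≤ (p : ℝ) ^ δ) (e : ℕ) :
    (e : ℝ) + 1 ≤ (p : ℝ) ^ (δ * e) := by
  rw [Real.rpow_mul (by positivity), Real.rpow_natCast]
  have h1 : (e : ℝ) + 1 ≤ 2 ^ e := by exact_mod_cast Nat.lt_two_pow_self (n := e)
  exact h1.trans (pow_le_pow_left₀ (by norm_num) hp e)

/-- The divisor bound `τ(n) ≪ n ^ δ`. Writing `τ(n)` and `n ^ δ` as products over primes, the local
factor `e + 1` is at most `p ^ (δ e)` as soon as `p ^ δ ≥ 2`, and the finitely many other primes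
cost a bounded factor each. -/
theorem exists_card_divisors_le_rpow {δ : ℝ} (hδ : 0 < δ) :
    ∃ C : ℝ, 1 ≤ C ∧ ∀ n : ℕ, n ≠ 0 → (n.divisors.card : ℝ) ≤ C * (n : ℝ) ^ δ := by
  set c : ℝ := 1 + 1 / (δ * Real.log 2) with hc
  have hl : 0 < Real.log 2 := Real.log_pos (by norm_num)
  have hc1 : 1 ≤ c := by
    rw [hc]
    have : 0 ≤ 1 / (δ * Real.log 2) := by positivity
    linarith
  set B : ℕ := ⌈(2 : ℝ) ^ (1 / δ)⌉₊ with hB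
  refine ⟨c ^ B, one_le_pow₀ hc1, fun n hn => ?_⟩
  have hnprod : (n : ℝ) ^ δ = ∏ p ∈ n.primeFactors, (p : ℝ) ^ (δ * n.factorization p) := by
    conv_lhs => rw [← Nat.prod_factorization_pow_eq_self hn]
    rw [Finsupp.prod, Nat.support_factorization]
    push_cast
    rw [← Real.finsetProd_rpow _ _ (fun p _ => by positivity)]
    refine Finset.prod_congr rfl fun p _ => ?_
    rw [← Real.rpow_natCast, ← Real.rpow_mul (by positivity), mul_comm]
  rw [Nat.card_divisors hn, hnprod]
  push_cast
  have key : ∏ p ∈ n.primeFactors, ((n.factorization p : ℝ) + 1)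
      ≤ ∏ p ∈ n.primeFactors, ((if p < B then c else 1) * (p : ℝ) ^ (δ * n.factorization p)) := by
    refine Finset.prod_le_prod (fun p _ => by positivity) fun p hp => ?_
    have hp2 : 2 ≤ p := (Nat.prime_of_mem_primeFactors hp).two_le
    split_ifs with h
    · exact add_one_le_mul_rpow hδ hp2 _
    · rw [one_mul]
      refine add_one_le_rpow ?_ _
      have h1 : (2 : ℝ) ^ (1 / δ) ≤ p := (Nat.le_ceil _).trans (by exact_mod_cast not_lt.mp h)
      calc (2 : ℝ) = ((2 : ℝ) ^ (1 / δ)) ^ δ := by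
            rw [← Real.rpow_mul (by norm_num), one_div, inv_mul_cancel₀ hδ.ne', Real.rpow_one]
        _ ≤ _ := Real.rpow_le_rpow (by positivity) h1 hδ.le
  refine key.trans ?_
  rw [Finset.prod_mul_distrib]
  refine mul_le_mul_of_nonneg_right ?_ (Finset.prod_nonneg fun p _ => by positivity)
  rw [Finset.prod_ite, Finset.prod_const, Finset.prod_const_one, mul_one]
  refine pow_le_pow_right₀ hc1 ?_
  calc _ ≤ (Finset.range B).card := Finset.card_le_card fun p hp => by
          simpa using (Finset.mem_filter.mp hp).2
    _ = B := Finset.card_range B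

/-! ### Harmonic sums and the mean value of `φ(a) / a` -/

theorem harmonic_eq_sum_one_div (n : ℕ) :
    ((harmonic n : ℚ) : ℝ) = ∑ a ∈ Finset.Icc 1 n, 1 / (a : ℝ) := by
  rw [harmonic_eq_sum_Icc]
  push_cast
  simp

theorem exists_harmonic_le_rpow {δ : ℝ} (hδ : 0 < δ) :
    ∃ C : ℝ, 1 ≤ C ∧ ∀ n : ℕ, 1 ≤ n → ((harmonic n : ℚ) : ℝ) ≤ C * (n : ℝ) ^ δ := by
  refine ⟨1 + 1 / δ, by have : 0 < 1 / δ := by positivity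
                        linarith, fun n hn => ?_⟩
  have h1 := harmonic_le_one_add_log n
  have h2 : Real.log n ≤ (n : ℝ) ^ δ / δ := Real.log_le_rpow_div (by positivity) hδ
  have h3 : (1 : ℝ) ≤ (n : ℝ) ^ δ := Real.one_le_rpow (by exact_mod_cast hn) hδ.le
  have : (1 + 1 / δ) * (n : ℝ) ^ δ = (n : ℝ) ^ δ + (n : ℝ) ^ δ / δ := by ring
  linarith

theorem one_le_harmonic {n : ℕ} (hn : 1 ≤ n) : (1 : ℝ) ≤ ((harmonic n : ℚ) : ℝ) := by
  rw [harmonic_eq_sum_one_div]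
  have := Finset.single_le_sum (f := fun a : ℕ => 1 / (a : ℝ)) (s := Finset.Icc 1 n)
    (fun i _ => by positivity) (Finset.mem_Icc.mpr ⟨le_rfl, hn⟩)
  simpa using this

theorem harmonic_mono {m n : ℕ} (h : m ≤ n) :
    ((harmonic m : ℚ) : ℝ) ≤ ((harmonic n : ℚ) : ℝ) := by
  rw [harmonic_eq_sum_one_div, harmonic_eq_sum_one_div]
  exact Finset.sum_le_sum_of_subset_of_nonneg (Finset.Icc_subset_Icc le_rfl h)
    fun i _ _ => by positivity

open ArithmeticFunction in
theorem hasSum_moebius_div_sq :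
    HasSum (fun n : ℕ => (moebius n : ℝ) / (n : ℝ) ^ 2) (1 / (riemannZeta 2).re) := by
  have h2 : (1 : ℝ) < (2 : ℂ).re := by norm_num
  have hz := LSeries_zeta_mul_Lseries_moebius h2
  rw [LSeries_zeta_eq_riemannZeta h2] at hz
  have hs : LSeriesSummable (fun n => ((moebius n : ℤ) : ℂ)) 2 := LSeriesSummable_moebius_iff.mpr h2
  have hsum : HasSum (fun n : ℕ => LSeries.term (fun n => ((moebius n : ℤ) : ℂ)) 2 n)
      (LSeries (fun n => ((moebius n : ℤ) : ℂ)) 2) := hs.hasSum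
  have hterm : ∀ n : ℕ, LSeries.term (fun n => ((moebius n : ℤ) : ℂ)) 2 n
      = (((moebius n : ℝ) / (n : ℝ) ^ 2 : ℝ) : ℂ) := by
    intro n
    rcases Nat.eq_zero_or_pos n with rfl | hn
    · simp
    · rw [LSeries.term_of_ne_zero hn.ne']
      push_cast
      congr 1
      exact_mod_cast Complex.cpow_natCast (n : ℂ) 2
  simp_rw [hterm] at hsum
  have him : (riemannZeta 2).im = 0 := by
    have := riemannZeta_im_eq_zero_of_one_lt (x := 2) (by norm_num)
    simpa using this
  have hval : LSeries (fun n => ((moebius n : ℤ) : ℂ)) 2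
      = ((1 / (riemannZeta 2).re : ℝ) : ℂ) := by
    have hre : riemannZeta 2 = ((riemannZeta 2).re : ℂ) := by
      apply Complex.ext <;> simp [him]
    rw [eq_comm]
    push_cast
    rw [← hre, one_div]
    exact inv_eq_of_mul_eq_one_right hz
  rw [hval] at hsum
  exact_mod_cast hsum

open ArithmeticFunction in
theorem abs_moebius_le_one_real (n : ℕ) : |(moebius n : ℝ)| ≤ 1 := by
  exact_mod_cast abs_moebius_le_one (n := n)

open ArithmeticFunction in
theorem abs_sum_moebius_div_sq_sub_le {n : ℕ} (hn : 1 ≤ n) :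
    |∑ d ∈ Finset.Icc 1 n, (moebius d : ℝ) / (d : ℝ) ^ 2 - 1 / (riemannZeta 2).re|
      ≤ 1 / (n : ℝ) := by
  have hlim := hasSum_moebius_div_sq.tendsto_sum_nat
  -- the partial sums beyond `n` stay within the telescoping bound `1 / n - 1 / m` of the `n`-th
  have hb : ∀ m : ℕ, n ≤ m →
      |∑ d ∈ Finset.Icc 1 n, (moebius d : ℝ) / (d : ℝ) ^ 2
        - ∑ d ∈ Finset.range (m + 1), (moebius d : ℝ) / (d : ℝ) ^ 2| ≤ 1 / (n : ℝ)
            - 1 / (m : ℝ) := by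
    intro m hm
    induction m, hm using Nat.le_induction with
    | base =>
      rw [Finset.range_eq_Ico, Finset.sum_eq_sum_Ico_succ_bot (by omega)]
      have : Finset.Ico (0 + 1) (n + 1) = Finset.Icc 1 n := by ext; simp
      simp [this]
    | succ m hm ih =>
      rw [Finset.sum_range_succ _ (m + 1)]
      have hm0 : (0 : ℝ) < m := by exact_mod_cast (by omega : 0 < m)
      have h1 : |(moebius (m + 1) : ℝ) / ((m + 1 : ℕ) : ℝ) ^ 2| ≤ 1 / (m : ℝ)
          - 1 / ((m + 1 : ℕ) : ℝ) := by
        rw [abs_div, abs_of_nonneg (by positivity : (0 : ℝ) ≤ ((m + 1 : ℕ) : ℝ) ^ 2)]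
        calc _ ≤ 1 / ((m + 1 : ℕ) : ℝ) ^ 2 :=
              div_le_div_of_nonneg_right (abs_moebius_le_one_real _) (by positivity)
          _ ≤ _ := by
            push_cast
            rw [div_sub_div _ _ hm0.ne' (by positivity),
                div_le_div_iff₀ (by positivity) (by positivity)]
            nlinarith
      rw [← sub_sub]
      refine (abs_sub _ _).trans ?_
      linarith
  have hlim' := (Filter.tendsto_add_atTop_iff_nat 1).mpr hlim
  refine le_of_tendsto ((tendsto_const_nhds.sub hlim').abs) ?_
  filter_upwards [Filter.eventually_ge_atTop n] with m hm
  refine (hb m hm).trans ?_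
  have : (0 : ℝ) ≤ 1 / (m : ℝ) := by positivity
  linarith

open ArithmeticFunction in
theorem totient_div_self_eq_sum {a : ℕ} (ha : a ≠ 0) :
    (a.totient : ℝ) / a = ∑ d ∈ a.divisors, (moebius d : ℝ) / d := by
  have hφ : ∀ n : ℕ, 0 < n → ∑ i ∈ n.divisors, ((i.totient : ℤ)) = (n : ℤ) := by
    intro n _
    exact_mod_cast Nat.sum_totient n
  have := (sum_eq_iff_sum_mul_moebius_eq (R := ℤ)
    (f := fun n => (n.totient : ℤ)) (g := fun n => (n : ℤ))).mp hφ a (Nat.pos_of_ne_zero ha)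
  have h2 : (a.totient : ℝ) = ∑ x ∈ a.divisorsAntidiagonal, (moebius x.1 : ℝ) * (x.2 : ℝ) := by
    have : ((a.totient : ℤ) : ℝ) = _ := congrArg (Int.cast) this.symm
    push_cast at this
    exact_mod_cast this
  rw [h2, Nat.sum_divisorsAntidiagonal (fun x y => (moebius x : ℝ) * (y : ℝ)), Finset.sum_div]
  refine Finset.sum_congr rfl fun d hd => ?_
  have hd' := Nat.dvd_of_mem_divisors hd
  have hd0 : (d : ℝ) ≠ 0 := by exact_mod_cast (Nat.pos_of_mem_divisors hd).ne'
  have ha0 : (a : ℝ) ≠ 0 := by exact_mod_cast ha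
  rw [Nat.cast_div hd' hd0]
  field_simp

/-- Interchanging a sum over `a ≤ n` with a sum over the divisors `d` of `a`. -/
theorem sum_Icc_sum_divisors (n : ℕ) (f : ℕ → ℝ) :
    ∑ a ∈ Finset.Icc 1 n, ∑ d ∈ a.divisors, f d
      = ∑ d ∈ Finset.Icc 1 n, f d * ((n / d : ℕ) : ℝ) := by
  have h1 : ∀ a ∈ Finset.Icc 1 n, ∑ d ∈ a.divisors, f d
      = ∑ d ∈ Finset.Icc 1 n, if d ∣ a then f d else 0 := by
    intro a ha
    rw [← Finset.sum_filter]
    refine Finset.sum_congr ?_ fun _ _ => rfl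
    ext d
    simp only [Finset.mem_Icc] at ha
    simp only [Nat.mem_divisors, Finset.mem_filter, Finset.mem_Icc]
    constructor
    · rintro ⟨h, h0⟩
      exact ⟨⟨Nat.pos_of_dvd_of_pos h (by omega), (Nat.le_of_dvd (by omega) h).trans ha.2⟩, h⟩
    · rintro ⟨_, h⟩
      exact ⟨h, by omega⟩
  rw [Finset.sum_congr rfl h1, Finset.sum_comm]
  refine Finset.sum_congr rfl fun d _ => ?_
  rw [← Finset.sum_filter, Finset.sum_const, nsmul_eq_mul, mul_comm]
  congr 2
  exact Nat.Ioc_filter_dvd_card_eq_div n d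

theorem abs_natCast_div_sub_le (N g : ℕ) : |((N / g : ℕ) : ℝ) - (N : ℝ) / g| ≤ 1 := by
  rw [← Nat.floor_div_eq_div (K := ℝ) N g, abs_le]
  have a1 := Nat.floor_le (by positivity : (0 : ℝ) ≤ (N : ℝ) / g)
  have a2 := Nat.lt_floor_add_one ((N : ℝ) / g)
  constructor <;> linarith

open ArithmeticFunction in
theorem abs_sum_totient_div_sub_le (n : ℕ) :
    |∑ a ∈ Finset.Icc 1 n, (a.totient : ℝ) / a - n / (riemannZeta 2).re|
      ≤ ((harmonic n : ℚ) : ℝ) + 1 := by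
  rcases Nat.eq_zero_or_pos n with rfl | hn
  · simp
  have h1 : ∑ a ∈ Finset.Icc 1 n, (a.totient : ℝ) / a
      = ∑ d ∈ Finset.Icc 1 n, (moebius d : ℝ) / d * ((n / d : ℕ) : ℝ) := by
    rw [← sum_Icc_sum_divisors]
    refine Finset.sum_congr rfl fun a ha => totient_div_self_eq_sum ?_
    have := (Finset.mem_Icc.mp ha).1
    omega
  have h2 := abs_sum_moebius_div_sq_sub_le hn
  have hn0 : (0 : ℝ) < n := by exact_mod_cast hn
  have h3 : |∑ d ∈ Finset.Icc 1 n, (moebius d : ℝ) / d * ((n / d : ℕ) : ℝ)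
      - n * ∑ d ∈ Finset.Icc 1 n, (moebius d : ℝ) / (d : ℝ) ^ 2| ≤ ((harmonic n : ℚ) : ℝ) := by
    rw [Finset.mul_sum, ← Finset.sum_sub_distrib, harmonic_eq_sum_one_div]
    refine (Finset.abs_sum_le_sum_abs _ _).trans (Finset.sum_le_sum fun d hd => ?_)
    have hd0 : (0 : ℝ) < d := by exact_mod_cast (Finset.mem_Icc.mp hd).1
    have e : (moebius d : ℝ) / d * ((n / d : ℕ) : ℝ) - n * ((moebius d : ℝ) / (d : ℝ) ^ 2)
        = (moebius d : ℝ) * ((1 / d) * (((n / d : ℕ) : ℝ) - n / d)) := by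
      field_simp
    rw [e, abs_mul, abs_mul, abs_of_pos (by positivity : 0 < 1 / (d : ℝ))]
    calc _ ≤ 1 * (1 / (d : ℝ) * 1) := by
          gcongr
          · exact abs_moebius_le_one_real d
          · exact abs_natCast_div_sub_le n d
      _ = _ := by ring
  have h5 : |n * ∑ d ∈ Finset.Icc 1 n, (moebius d : ℝ) / (d : ℝ) ^ 2 - n / (riemannZeta 2).re|
      ≤ 1 := by
    have : n * ∑ d ∈ Finset.Icc 1 n, (moebius d : ℝ) / (d : ℝ) ^ 2 - n / (riemannZeta 2).re
        = n * (∑ d ∈ Finset.Icc 1 n, (moebius d : ℝ) / (d : ℝ) ^ 2 - 1 / (riemannZeta 2).re) := by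
      ring
    rw [this, abs_mul, abs_of_pos hn0]
    calc _ ≤ (n : ℝ) * (1 / n) := by gcongr
      _ = 1 := by field_simp
  rw [h1]
  exact (abs_sub_le _ _ _).trans (add_le_add h3 h5)

/-- `∑_{a ≤ n} gcd(k, a) ≤ τ(k) n`. -/
theorem sum_gcd_le {k : ℕ} (hk : k ≠ 0) (n : ℕ) :
    ∑ a ∈ Finset.Icc 1 n, (Nat.gcd k a : ℝ) ≤ k.divisors.card * n := by
  have h1 : ∀ a ∈ Finset.Icc 1 n, (Nat.gcd k a : ℝ)
      ≤ ∑ d ∈ a.divisors, if d ∣ k then (d : ℝ) else 0 := by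
    intro a ha
    have ha0 : a ≠ 0 := by have := (Finset.mem_Icc.mp ha).1; omega
    have hmem : Nat.gcd k a ∈ a.divisors := Nat.mem_divisors.mpr ⟨Nat.gcd_dvd_right k a, ha0⟩
    have := Finset.single_le_sum (f := fun d : ℕ => if d ∣ k then (d : ℝ) else 0)
      (fun d _ => by positivity) hmem
    simpa [Nat.gcd_dvd_left] using this
  refine (Finset.sum_le_sum h1).trans ?_
  rw [sum_Icc_sum_divisors]
  calc _ ≤ ∑ d ∈ Finset.Icc 1 n, if d ∣ k then (n : ℝ) else 0 := by
        refine Finset.sum_le_sum fun d hd => ?_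
        split_ifs
        · exact_mod_cast Nat.mul_div_le n d
        · simp
    _ = ((Finset.Icc 1 n).filter (· ∣ k)).card * n := by
        rw [← Finset.sum_filter, Finset.sum_const, nsmul_eq_mul]
    _ ≤ _ := by
        gcongr
        intro d hd
        exact Nat.mem_divisors.mpr ⟨(Finset.mem_filter.mp hd).2, hk⟩

/-! ### Sawtooth sums over reduced residues -/

/-- The sawtooth `1 - 2 {t / a}` of a residue class `t` modulo `a`, where `{t / a} ∈ [0, 1)` is
computed from the least nonnegative representative of `t`. -/
noncomputable def sawtooth (a : ℕ) (z : ZMod a) : ℝ := 1 - 2 * (z.val : ℝ) / a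

theorem abs_sawtooth_le_one {a : ℕ} [NeZero a] (z : ZMod a) : |sawtooth a z| ≤ 1 := by
  have ha : (0 : ℝ) < a := by exact_mod_cast Nat.pos_of_ne_zero (NeZero.ne a)
  have h1 : (z.val : ℝ) / a ≤ 1 := by
    rw [div_le_one ha]
    exact_mod_cast (ZMod.val_lt z).le
  have h2 : (0 : ℝ) ≤ (z.val : ℝ) / a := by positivity
  rw [sawtooth, mul_div_assoc, abs_le]
  constructor <;> linarith

theorem sawtooth_intCast (a : ℕ) [NeZero a] (t : ℤ) :
    sawtooth a (t : ZMod a) = 1 - 2 * ((t % a : ℤ) : ℝ) / a := by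
  rw [sawtooth, ← ZMod.val_intCast]
  simp

theorem sum_range_natCast_zmod (n : ℕ) [NeZero n] (F : ZMod n → ℝ) :
    ∑ i ∈ Finset.range n, F (i : ZMod n) = ∑ z, F z := by
  refine Finset.sum_bij (fun i _ => (i : ZMod n)) (fun _ _ => Finset.mem_univ _) ?_ ?_ ?_
  · intro i hi j hj hij
    rw [ZMod.natCast_eq_natCast_iff'] at hij
    rwa [Nat.mod_eq_of_lt (Finset.mem_range.mp hi),
        Nat.mod_eq_of_lt (Finset.mem_range.mp hj)] at hij
  · intro z _
    exact ⟨z.val, Finset.mem_range.mpr (ZMod.val_lt z), ZMod.natCast_zmod_val z⟩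
  · intro _ _
    rfl

theorem map_emod_of_periodic {n : ℕ} {G : ℤ → ℝ} (hG : ∀ t, G (t + n) = G t) (t : ℤ) :
    G (t % n) = G t := by
  have h : Function.Periodic G (n : ℤ) := hG
  have := h.int_mul (t / n) (t % n)
  rw [← this]
  congr 1
  have := Int.emod_add_mul_ediv t n
  rw [mul_comm] at this
  simpa using this

/-- A function of period `n` has the same sum over `n` consecutive integers as over their multiples
by a number coprime to `n`, shifted. -/
theorem sum_range_mul_add_of_periodic {n : ℕ} [NeZero n] {G : ℤ → ℝ} (hG : ∀ t, G (t + n) = G t)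
    {u : ℤ} (hu : IsUnit (u : ZMod n)) (v : ℤ) :
    ∑ i ∈ Finset.range n, G (u * i + v) = ∑ i ∈ Finset.range n, G i := by
  set F : ZMod n → ℝ := fun z => G (z.val : ℤ) with hF
  have hGF : ∀ t : ℤ, G t = F (t : ZMod n) := by
    intro t
    simp only [hF]
    rw [ZMod.val_intCast, map_emod_of_periodic hG]
  have h1 : ∀ i : ℕ, G (u * i + v) = (fun z : ZMod n => F ((u : ZMod n) * z + v)) (i : ZMod n) := by
    intro i
    rw [hGF]
    push_cast
    rfl
  have h2 : ∀ i : ℕ, G i = F (i : ZMod n) := by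
    intro i
    rw [hGF]
    push_cast
    rfl
  simp_rw [h1, h2]
  rw [sum_range_natCast_zmod n (fun z : ZMod n => F ((u : ZMod n) * z + v)),
    sum_range_natCast_zmod n F]
  have hbij : Function.Bijective (fun z : ZMod n => (u : ZMod n) * z + v) :=
    (Equiv.addRight (v : ZMod n)).bijective.comp hu.unit.mulLeft_bijective
  exact hbij.sum_comp F

theorem sum_range_mul_of_periodic {n : ℕ} {G : ℤ → ℝ} (hG : ∀ t, G (t + n) = G t) (k : ℕ) :
    ∑ i ∈ Finset.range (k * n), G i = k * ∑ i ∈ Finset.range n, G i := by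
  induction k with
  | zero => simp
  | succ k ih =>
    rw [add_mul, one_mul, Finset.sum_range_add, ih]
    push_cast
    rw [add_mul, one_mul]
    congr 1
    refine Finset.sum_congr rfl fun i _ => ?_
    have h : Function.Periodic G (n : ℤ) := hG
    have := h.int_mul k i
    rw [← this]
    congr 1
    push_cast
    ring

/-- The distribution relation for the sawtooth. -/
theorem sum_sawtooth_add_mul (q n : ℕ) [NeZero q] [NeZero n] (t : ℤ) :
    ∑ i ∈ Finset.range n, sawtooth (q * n) ((t + q * i : ℤ) : ZMod (q * n))
      = sawtooth q (t : ZMod q) := by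
  have hq : (0 : ℝ) < q := by exact_mod_cast Nat.pos_of_ne_zero (NeZero.ne q)
  have hn : (0 : ℝ) < n := by exact_mod_cast Nat.pos_of_ne_zero (NeZero.ne n)
  have hqz : (0 : ℤ) < q := by exact_mod_cast Nat.pos_of_ne_zero (NeZero.ne q)
  have hmod : ∀ i : ℕ, (t + q * i) % ((q * n : ℕ) : ℤ) = t % q + q * ((t / q + i) % n) := by
    intro i
    have hnz : (0 : ℤ) < n := by exact_mod_cast Nat.pos_of_ne_zero (NeZero.ne n)
    have h1 := Int.emod_add_mul_ediv t q
    have h2 := Int.emod_add_mul_ediv (t / q + i) n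
    have h3 := Int.emod_nonneg t hqz.ne'
    have h4 := Int.emod_lt_of_pos t hqz
    have h5 := Int.emod_nonneg (t / q + i) hnz.ne'
    have h6 := Int.emod_lt_of_pos (t / q + i) hnz
    have h7 : t + q * i = (t % q + q * ((t / q + i) % n)) + ((q * n : ℕ) : ℤ)
        * ((t / q + i) / n) := by
      push_cast
      linear_combination (-1) * h1 - q * h2
    rw [h7, Int.add_mul_emod_self_left]
    refine Int.emod_eq_of_lt (by positivity) ?_
    push_cast
    have : (q : ℤ) * ((t / q + i) % n) ≤ q * (n - 1) :=
        mul_le_mul_of_nonneg_left (by linarith) hqz.le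
    linarith
  have hsum : ∑ i ∈ Finset.range n, (((t / q + i) % n : ℤ) : ℝ) = n * (n - 1) / 2 := by
    have hper : ∀ s : ℤ, (fun s : ℤ => ((s % n : ℤ) : ℝ)) (s + n)
        = (fun s : ℤ => ((s % n : ℤ) : ℝ)) s := by
      intro s
      simp
    have h1 := sum_range_mul_add_of_periodic (n := n) (G := fun s : ℤ =>
        ((s % n : ℤ) : ℝ)) hper (u := 1) (by simp) (t / q)
    have h2 : ∑ i ∈ Finset.range n, (((i : ℤ) % n : ℤ) : ℝ) = ∑ i ∈ Finset.range n, (i : ℝ) := by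
      refine Finset.sum_congr rfl fun i hi => ?_
      rw [Int.emod_eq_of_lt (by positivity) (by exact_mod_cast Finset.mem_range.mp hi)]
      simp
    have h3 : (∑ i ∈ Finset.range n, (i : ℝ)) * 2 = n * (n - 1) := by
      have := Finset.sum_range_id_mul_two n
      have h4 : (((∑ i ∈ Finset.range n, i) * 2 : ℕ) : ℝ) = ((n * (n - 1) : ℕ) : ℝ) := by rw [this]
      push_cast [Nat.cast_sub (Nat.pos_of_ne_zero (NeZero.ne n))] at h4
      exact_mod_cast h4
    simp only [one_mul] at h1
    simp_rw [add_comm (t / (q : ℤ))]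
    rw [h1, h2]
    linarith
  simp_rw [sawtooth_intCast, hmod]
  push_cast at hsum ⊢
  have e : ∀ i : ℕ, (1 : ℝ) - 2 * (((t % q : ℤ) : ℝ) + q * (((t / q + i) % n : ℤ) : ℝ)) / (q * n)
      = (1 - 2 * ((t % q : ℤ) : ℝ) / (q * n)) - 2 / n * (((t / q + i) % n : ℤ) : ℝ) := by
    intro i
    field_simp
    ring
  simp_rw [e]
  rw [Finset.sum_sub_distrib, ← Finset.mul_sum, hsum, Finset.sum_const, Finset.card_range,
      nsmul_eq_mul]
  field_simp
  ring

theorem abs_sum_sawtooth_sub_mul_le (δ n h : ℕ) [NeZero δ] [NeZero n] (N : ℤ) :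
    |∑ j ∈ Finset.range n, sawtooth (δ * n) ((N - h * (δ * j) : ℤ) : ZMod (δ * n))|
      ≤ Nat.gcd h n := by
  obtain ⟨k, h', n', hk, hcop, rfl, rfl⟩ := Nat.exists_coprime' (m := h) (n := n)
    (Nat.gcd_pos_of_pos_right _ (Nat.pos_of_ne_zero (NeZero.ne n)))
  have hn' : NeZero n' := ⟨by
    have := NeZero.ne (n' * k)
    rintro rfl
    simp at this⟩
  have hk' : NeZero k := ⟨hk.ne'⟩
  have hgcd : Nat.gcd (h' * k) (n' * k) = k := by
    rw [Nat.gcd_mul_right, hcop, one_mul]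
  have hmodulus : δ * (n' * k) = (δ * k) * n' := by ring
  rw [hgcd, hmodulus]
  set G : ℤ → ℝ := fun i =>
      sawtooth ((δ * k) * n') ((N + ((δ * k : ℕ) : ℤ) * i : ℤ) : ZMod ((δ * k) * n'))
    with hG
  have hper : ∀ t, G (t + n') = G t := by
    intro t
    simp only [hG]
    congr 1
    have : ((((δ * k) * n' : ℕ) : ℤ) : ZMod ((δ * k) * n')) = 0 := by
      rw [Int.cast_natCast, ZMod.natCast_self]
    have e : N + ((δ * k : ℕ) : ℤ) * (t + n') = N + ((δ * k : ℕ) : ℤ) * t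
        + (((δ * k) * n' : ℕ) : ℤ) := by
      push_cast; ring
    rw [e, Int.cast_add _ (((δ * k) * n' : ℕ) : ℤ), this, add_zero]
  have hper' : ∀ t, (fun t => G (-h' * t + 0)) (t + n') = (fun t => G (-h' * t + 0)) t := by
    intro t
    have h : Function.Periodic G (n' : ℤ) := hper
    have := h.int_mul (-h') (-h' * t)
    simp only [add_zero]
    rw [← this]
    congr 1
    simp; ring
  have hterm : ∀ j : ℕ,
      sawtooth ((δ * k) * n') ((N - ((h' * k : ℕ) : ℤ) * (δ * j) : ℤ) : ZMod ((δ * k) * n'))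
      = G (-h' * j + 0) := by
    intro j
    simp only [hG]
    congr 2
    push_cast
    ring
  simp_rw [hterm]
  rw [mul_comm n' k]
  rw [sum_range_mul_of_periodic (G := fun t => G (-h' * t + 0)) hper' k]
  have hu : IsUnit ((-(h' : ℤ) : ℤ) : ZMod n') := by
    push_cast
    exact ((ZMod.isUnit_iff_coprime h' n').mpr hcop).neg
  rw [sum_range_mul_add_of_periodic hper hu 0]
  simp only [hG]
  rw [sum_sawtooth_add_mul, abs_mul, abs_of_nonneg (by positivity : (0 : ℝ) ≤ k)]
  calc (k : ℝ) * _ ≤ k * 1 := by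
        gcongr
        exact abs_sawtooth_le_one _
    _ = k := mul_one _

theorem sum_units_eq_sum_ite {a : ℕ} [NeZero a] (f : ZMod a → ℝ)
    [DecidablePred (IsUnit (M := ZMod a))] :
    ∑ u : (ZMod a)ˣ, f u = ∑ z : ZMod a, if IsUnit z then f z else 0 := by
  rw [← Finset.sum_filter]
  refine Finset.sum_bij (fun u _ => (u : ZMod a)) (fun u _ => by simp) (fun u _ v _ h =>
      Units.ext h)
    (fun z hz => ?_) (fun _ _ => rfl)
  obtain ⟨u, rfl⟩ := (Finset.mem_filter.mp hz).2
  exact ⟨u, Finset.mem_univ _, rfl⟩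

open ArithmeticFunction in
/-- Cancellation in the sum of the sawtooth over an affine image of the reduced residues. Möbius
inversion removes the coprimality condition, and each resulting complete sum collapses by the
distribution relation. -/
theorem abs_sum_units_sawtooth_le (a h : ℕ) [NeZero a] (N : ℤ) :
    |∑ u : (ZMod a)ˣ, sawtooth a ((N : ZMod a) - h * (u : ZMod a))| ≤ a.divisors.card
        * Nat.gcd h a := by
  classical
  have ha : a ≠ 0 := NeZero.ne a
  rw [sum_units_eq_sum_ite (fun z : ZMod a => sawtooth a ((N : ZMod a) - h * z)),
      ← sum_range_natCast_zmod a]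
  have hmoeb : ∀ w ∈ Finset.range a,
      (if IsUnit (w : ZMod a) then sawtooth a ((N : ZMod a) - h * (w : ZMod a)) else 0)
      = ∑ δ ∈ a.divisors, if δ ∣ w then (moebius δ : ℝ)
          * sawtooth a ((N : ZMod a) - h * (w : ZMod a)) else 0 := by
    intro w _
    have hg : Nat.gcd w a ≠ 0 := Nat.gcd_ne_zero_right ha
    have h1 : ∑ δ ∈ (Nat.gcd w a).divisors, (moebius δ : ℤ) = if Nat.gcd w a = 1 then 1 else 0 := by
      rw [← coe_mul_zeta_apply, moebius_mul_coe_zeta, one_apply]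
    have h2 : (Nat.gcd w a).divisors = a.divisors.filter (· ∣ w) := by
      ext δ
      simp only [Nat.mem_divisors, Finset.mem_filter, Nat.dvd_gcd_iff]
      tauto
    rw [← Finset.sum_filter, ← h2, ← Finset.sum_mul]
    have h3 : ∑ δ ∈ (Nat.gcd w a).divisors, (moebius δ : ℝ) = if Nat.gcd w a = 1 then 1 else 0 := by
      exact_mod_cast congrArg (Int.cast (R := ℝ)) h1
    rw [h3]
    simp only [ZMod.isUnit_iff_coprime, Nat.Coprime]
    split_ifs <;> simp
  rw [Finset.sum_congr rfl hmoeb, Finset.sum_comm]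
  have hbound : ∀ δ ∈ a.divisors,
      |∑ w ∈ Finset.range a, if δ ∣ w then (moebius δ : ℝ)
          * sawtooth a ((N : ZMod a) - h * (w : ZMod a)) else 0|
        ≤ Nat.gcd h a := by
    intro δ hδ
    obtain ⟨n, rfl⟩ := Nat.dvd_of_mem_divisors hδ
    have hδ0 : NeZero δ := ⟨by rintro rfl; simp at ha⟩
    have hn0 : NeZero n := ⟨by rintro rfl; simp at ha⟩
    have hre : ∑ w ∈ Finset.range (δ * n),
        (if δ ∣ w then (moebius δ : ℝ)
        * sawtooth (δ * n) ((N : ZMod (δ * n)) - h * (w : ZMod (δ * n))) else 0)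
        = moebius δ * ∑ j ∈ Finset.range n,
            sawtooth (δ * n) ((N - h * (δ * j) : ℤ) : ZMod (δ * n)) := by
      rw [← Finset.sum_filter, ← Finset.mul_sum]
      congr 1
      symm
      refine Finset.sum_bij (fun j _ => δ * j) ?_ ?_ ?_ ?_
      · intro j hj
        rw [Finset.mem_filter, Finset.mem_range]
        exact ⟨Nat.mul_lt_mul_of_pos_left (Finset.mem_range.mp hj) (Nat.pos_of_ne_zero hδ0.ne),
            dvd_mul_right _ _⟩
      · intro i _ j _ hij
        exact Nat.eq_of_mul_eq_mul_left (Nat.pos_of_ne_zero hδ0.ne) hij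
      · intro w hw
        rw [Finset.mem_filter, Finset.mem_range] at hw
        obtain ⟨hw1, j, rfl⟩ := hw
        exact ⟨j, Finset.mem_range.mpr (lt_of_mul_lt_mul_left hw1 (Nat.zero_le _)), rfl⟩
      · intro j _
        push_cast
        rfl
    rw [hre, abs_mul]
    have h1 := abs_sum_sawtooth_sub_mul_le δ n h N
    have h2 : (Nat.gcd h n : ℝ) ≤ Nat.gcd h (δ * n) := by
      exact_mod_cast Nat.le_of_dvd (Nat.gcd_pos_of_pos_right _ (Nat.pos_of_ne_zero ha))
        (Nat.gcd_dvd_gcd_mul_left_right h n δ)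
    calc _ ≤ 1 * (Nat.gcd h (δ * n) : ℝ) :=
          mul_le_mul (abs_moebius_le_one_real δ) (h1.trans h2) (abs_nonneg _) zero_le_one
      _ = _ := one_mul _
  refine (Finset.abs_sum_le_sum_abs _ _).trans ((Finset.sum_le_sum hbound).trans ?_)
  rw [Finset.sum_const, nsmul_eq_mul]

/-! ### Points of a line in the positive quadrant -/

/-- The number of `(x, y) ∈ ℕ²` with `a x + c y + h = N (a + c)`; for positive `a` and `c` the
bounds on `x` and `y` in the definition hold automatically. -/
def lineCount (h N a c : ℕ) : ℕ :=
  ((Finset.range (N * (a + c) + 1) ×ˢ Finset.range (N * (a + c) + 1)).filter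
    fun p => a * p.1 + c * p.2 + h = N * (a + c)).card

/-- The sawtooth at the least `y ≥ 0` for which some integer `x` satisfies
`a x + c y + h = N (a + c)`. -/
noncomputable def lineSawtooth (h N a c : ℕ) : ℝ :=
  sawtooth a ((N : ZMod a) - h * (c : ZMod a)⁻¹)

theorem natCast_eq_of_line {h N a c : ℕ} (hcop : c.Coprime a) {x y : ℕ}
    (he : a * x + c * y + h = N * (a + c)) :
    (y : ZMod a) = (N : ZMod a) - h * (c : ZMod a)⁻¹ := by
  have hinv := ZMod.coe_mul_inv_eq_one c hcop
  have h1 : ((a * x + c * y + h : ℕ) : ZMod a) = ((N * (a + c) : ℕ) : ZMod a) := by rw [he]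
  push_cast at h1
  rw [ZMod.natCast_self] at h1
  linear_combination (c : ZMod a)⁻¹ * h1 - (y - N : ZMod a) * hinv

/-- The residue defining `lineSawtooth` is the `y`-coordinate of an integer solution. -/
theorem dvd_of_lineSawtooth_residue {h N a c : ℕ} [NeZero a] (hcop : c.Coprime a) :
    (a : ℤ) ∣ c * (((N : ZMod a) - h * (c : ZMod a)⁻¹).val : ℤ) + h - N * c := by
  rw [← ZMod.intCast_zmod_eq_zero_iff_dvd]
  push_cast
  rw [ZMod.natCast_zmod_val]
  have hinv := ZMod.coe_mul_inv_eq_one c hcop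
  linear_combination (-h : ZMod a) * hinv

/-- If `x₀ < c` and `y₀ < a` are the least nonnegative residues of the coordinates of a solution,
the solutions in the quadrant are the `(x₀ + c i, y₀ + a j)` with `i, j ≥ 0` and `i + j` a fixed
integer, which is at least `-1`. -/
theorem lineCount_eq {h N a c : ℕ} (ha : 0 < a) (hc : 0 < c) (hcop : a.Coprime c)
    (hle : h ≤ N * (a + c)) :
    (lineCount h N a c : ℝ) = ((N : ℝ) * (a + c) - h) / (a * c)
      + (lineSawtooth h N a c + lineSawtooth h N c a) / 2 := by
  have : NeZero a := ⟨ha.ne'⟩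
  have : NeZero c := ⟨hc.ne'⟩
  set y₀ := ((N : ZMod a) - h * (c : ZMod a)⁻¹).val with hy₀
  set x₀ := ((N : ZMod c) - h * (a : ZMod c)⁻¹).val with hx₀
  have hy₀a : y₀ < a := ZMod.val_lt _
  have hx₀c : x₀ < c := ZMod.val_lt _
  have hd1 : (a : ℤ) ∣ c * (y₀ : ℤ) + h - N * c := dvd_of_lineSawtooth_residue hcop.symm
  have hd2 : (c : ℤ) ∣ a * (x₀ : ℤ) + h - N * a := dvd_of_lineSawtooth_residue hcop
  have hd : ((a : ℤ) * c) ∣ a * x₀ + c * y₀ + h - N * (a + c) := by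
    refine IsCoprime.mul_dvd (Nat.isCoprime_iff_coprime.mpr hcop) ?_ ?_
    · have := dvd_add hd1 (dvd_mul_right (a : ℤ) (x₀ - N))
      convert this using 1
      ring
    · have := dvd_add hd2 (dvd_mul_right (c : ℤ) (y₀ - N))
      convert this using 1
      ring
  obtain ⟨k', hk'⟩ := hd
  have hacz : (0 : ℤ) < a * c := by positivity
  have hk2 : k' < 2 := by
    have h1 : (a : ℤ) * x₀ < a * c := by exact_mod_cast Nat.mul_lt_mul_of_pos_left hx₀c ha
    have h2 : (c : ℤ) * y₀ < c * a := by exact_mod_cast Nat.mul_lt_mul_of_pos_left hy₀a hc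
    have h3 : (h : ℤ) ≤ N * (a + c) := by exact_mod_cast hle
    have h4 : (a : ℤ) * c * k' < a * c * 2 := by rw [← hk']; linarith
    exact lt_of_mul_lt_mul_left h4 hacz.le
  -- the solutions are `(x₀ + c i, y₀ + a j)` with `i + j = -k'`, and `-k' ≥ -1`
  obtain ⟨n, hn⟩ : ∃ n : ℕ, (n : ℤ) = 1 - k' := ⟨(1 - k').toNat, Int.toNat_of_nonneg (by linarith)⟩
  have hcard : lineCount h N a c = n := by
    rw [lineCount, ← Finset.card_range n]
    symm
    refine Finset.card_bij (fun i _ => (x₀ + c * i, y₀ + a * (n - 1 - i))) ?_ ?_ ?_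
    · intro i hi
      have hi' : i + 1 ≤ n := Finset.mem_range.mp hi
      have hline : a * (x₀ + c * i) + c * (y₀ + a * (n - 1 - i)) + h = N * (a + c) := by
        obtain ⟨j, rfl⟩ := Nat.exists_eq_add_of_le hi'
        have : i + 1 + j - 1 - i = j := by omega
        rw [this]
        zify
        push_cast at hn
        have hk'' : k' = -(i + j) := by linarith
        rw [hk''] at hk'
        linear_combination hk'
      simp only [Finset.mem_filter, Finset.mem_product, Finset.mem_range]
      refine ⟨⟨?_, ?_⟩, hline⟩
      · have := Nat.le_mul_of_pos_left (x₀ + c * i) ha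
        omega
      · have := Nat.le_mul_of_pos_left (y₀ + a * (n - 1 - i)) hc
        omega
    · intro i _ j _ hij
      have := (Prod.ext_iff.mp hij).1
      simp only at this
      exact Nat.eq_of_mul_eq_mul_left hc (by omega)
    · rintro ⟨x, y⟩ hp
      simp only [Finset.mem_filter] at hp
      have he := hp.2
      have hy : y % a = y₀ := by
        rw [hy₀, ← natCast_eq_of_line hcop.symm he, ZMod.val_natCast]
      have he' : c * y + a * x + h = N * (c + a) := by linarith
      have hx : x % c = x₀ := by
        rw [hx₀, ← natCast_eq_of_line hcop he', ZMod.val_natCast]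
      have hx' := Nat.mod_add_div x c
      have hy' := Nat.mod_add_div y a
      rw [hx] at hx'
      rw [hy] at hy'
      have hsum : ((x / c : ℕ) : ℤ) + ((y / a : ℕ) : ℤ) = -k' := by
        have e1 : (x : ℤ) = x₀ + c * ((x / c : ℕ) : ℤ) := by exact_mod_cast hx'.symm
        have e2 : (y : ℤ) = y₀ + a * ((y / a : ℕ) : ℤ) := by exact_mod_cast hy'.symm
        have e3 : (a : ℤ) * x + c * y + h = N * (a + c) := by exact_mod_cast he
        rw [e1, e2] at e3
        refine mul_left_cancel₀ hacz.ne' ?_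
        linear_combination e3 - hk'
      generalize x / c = i at hx' hsum ⊢
      generalize y / a = j at hy' hsum ⊢
      refine ⟨i, Finset.mem_range.mpr (by omega), ?_⟩
      refine Prod.ext hx' ?_
      have : n - 1 - i = j := by omega
      simp only [this]
      exact hy'
  rw [hcard, lineSawtooth, lineSawtooth, sawtooth, sawtooth, ← hy₀, ← hx₀]
  have hnr : (n : ℝ) = 1 - k' := by exact_mod_cast hn
  have hkr : (a : ℝ) * x₀ + c * y₀ + h - N * (a + c) = a * c * k' := by exact_mod_cast hk'
  have ha0 : (a : ℝ) ≠ 0 := by exact_mod_cast ha.ne'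
  have hc0 : (c : ℝ) ≠ 0 := by exact_mod_cast hc.ne'
  rw [hnr]
  field_simp
  linear_combination 2 * hkr

theorem lineCount_eq_zero {h N a c : ℕ} (hlt : N * (a + c) < h) : lineCount h N a c = 0 := by
  rw [lineCount, Finset.card_eq_zero, Finset.filter_eq_empty_iff]
  intro p _
  omega

/-! ### Coprime pairs in the corner `a + c > X` of the square `[1, X]²` -/

theorem sum_Ioc_natCast_zmod {a X : ℕ} [NeZero a] (haX : a ≤ X) (f : ZMod a → ℝ) :
    ∑ c ∈ Finset.Ioc (X - a) X, f (c : ZMod a) = ∑ z, f z := by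
  have h1 : Finset.Ioc (X - a) X = Finset.Ico (X - a + 1) (X + 1) := by
    ext; simp only [Finset.mem_Ioc, Finset.mem_Ico]; omega
  have h2 : X + 1 - (X - a + 1) = a := by omega
  rw [h1, Finset.sum_Ico_eq_sum_range, h2]
  have h3 := sum_range_natCast_zmod a (fun z => f (((X - a + 1 : ℕ) : ZMod a) + z))
  rw [← (Equiv.addLeft ((X - a + 1 : ℕ) : ZMod a)).bijective.sum_comp f]
  simp only [Equiv.coe_addLeft]
  rw [← h3]
  exact Finset.sum_congr rfl fun i _ => by push_cast; rfl

/-- The coprime pairs `(a, c)` in `[1, X]²`. -/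
def coprimePairs (X : ℕ) : Finset (ℕ × ℕ) :=
  (Finset.Icc 1 X ×ˢ Finset.Icc 1 X).filter fun p => p.1.Coprime p.2

theorem mem_coprimePairs {X : ℕ} {p : ℕ × ℕ} :
    p ∈ coprimePairs X ↔ ((1 ≤ p.1 ∧ p.1 ≤ X) ∧ (1 ≤ p.2 ∧ p.2 ≤ X)) ∧ p.1.Coprime p.2 := by
  simp [coprimePairs]

theorem sum_coprimePairs_swap (X : ℕ) (f : ℕ × ℕ → ℝ) :
    ∑ p ∈ coprimePairs X, f p.swap = ∑ p ∈ coprimePairs X, f p := by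
  refine Finset.sum_nbij' Prod.swap Prod.swap ?_ ?_ ?_ ?_ ?_
  · intro p hp
    rw [mem_coprimePairs] at hp ⊢
    exact ⟨⟨hp.1.2, hp.1.1⟩, hp.2.symm⟩
  · intro p hp
    rw [mem_coprimePairs] at hp ⊢
    exact ⟨⟨hp.1.2, hp.1.1⟩, hp.2.symm⟩
  · simp
  · simp
  · simp

/-- For fixed `a ≤ X`, the corner condition `a + c > X` lets `c` run over a complete residue system
modulo `a`, of which coprimality keeps the units. The sum over units is a `finsum` because `ZMod a`
is finite only for the nonzero `a` that occur. -/
theorem sum_coprimePairs_corner (X : ℕ) (f : (a : ℕ) → ZMod a → ℝ) :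
    ∑ p ∈ coprimePairs X, (if X < p.1 + p.2 then f p.1 (p.2 : ZMod p.1) else 0)
      = ∑ a ∈ Finset.Icc 1 X, ∑ᶠ u : (ZMod a)ˣ, f a u := by
  classical
  rw [coprimePairs, Finset.sum_filter, Finset.sum_product]
  refine Finset.sum_congr rfl fun a ha => ?_
  rw [Finset.mem_Icc] at ha
  have : NeZero a := ⟨by omega⟩
  rw [finsum_eq_sum_of_fintype, sum_units_eq_sum_ite (f a), ← sum_Ioc_natCast_zmod ha.2]
  have hsub : Finset.Ioc (X - a) X ⊆ Finset.Icc 1 X := by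
    intro c hc
    simp only [Finset.mem_Ioc, Finset.mem_Icc] at hc ⊢
    omega
  rw [← Finset.sum_subset hsub]
  · refine Finset.sum_congr rfl fun c hc => ?_
    have : X < a + c := by
      have := (Finset.mem_Ioc.mp hc).1
      omega
    simp only [this, if_true, ZMod.isUnit_iff_coprime, Nat.coprime_comm]
  · intro c hc hc'
    have : ¬ X < a + c := by
      simp only [Finset.mem_Ioc, Finset.mem_Icc] at hc hc'
      omega
    simp [this]

/-- The Farey identity: `1 / (a c)` sums to `1` over the coprime pairs in the corner, that is, over
the pairs of neighbouring denominators of the Farey sequence of order `X`. -/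
theorem sum_coprimePairs_corner_inv_mul {X : ℕ} (hX : 1 ≤ X) :
    ∑ p ∈ coprimePairs X, (if X < p.1 + p.2 then 1 / ((p.1 : ℝ) * p.2) else 0) = 1 := by
  induction X, hX using Nat.le_induction with
  | base =>
    have : coprimePairs 1 = {(1, 1)} := by
      ext ⟨a, c⟩
      rw [mem_coprimePairs]
      simp only [Finset.mem_singleton, Prod.mk.injEq]
      constructor
      · rintro ⟨h1, _⟩
        omega
      · rintro ⟨rfl, rfl⟩
        simp
    simp [this]
  | succ X hX ih =>
    have hIcc : Finset.Icc 1 (X + 1) = insert (X + 1) (Finset.Icc 1 X) := by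
      ext; simp only [Finset.mem_Icc, Finset.mem_insert]; omega
    have hnot : X + 1 ∉ Finset.Icc 1 X := by simp
    have hself : ¬ (X + 1).Coprime (X + 1) := by
      rw [Nat.coprime_self]; omega
    rw [coprimePairs, Finset.sum_filter, Finset.sum_product] at ih ⊢
    set s := Finset.Icc 1 X with hs
    -- the terms common to both levels, the ones gained and the ones lost
    have hnew : ∀ a ∈ s, (if a.Coprime (X + 1) then
        (if X + 1 < a + (X + 1) then 1 / ((a : ℝ) * ((X + 1 : ℕ) : ℝ)) else 0) else 0)
        = (if a.Coprime (X + 1) then 1 / (a : ℝ) else 0) / ((X : ℝ) + 1) := by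
      intro a ha
      have : X + 1 < a + (X + 1) := by have := (Finset.mem_Icc.mp ha).1; omega
      rw [if_pos this]
      split_ifs
      · push_cast
        rw [div_div]
      · simp
    have hnew' : ∀ c ∈ s,
        (if (X + 1).Coprime c then
        (if X + 1 < (X + 1) + c then 1 / (((X + 1 : ℕ) : ℝ) * (c : ℝ)) else 0) else 0)
        = (if c.Coprime (X + 1) then 1 / (c : ℝ) else 0) / ((X : ℝ) + 1) := by
      intro c hc
      rw [← hnew c hc]
      simp only [Nat.coprime_comm, add_comm c, mul_comm (c : ℝ)]
    have hsplit : ∀ a ∈ s, ∑ c ∈ s,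
        (if a.Coprime c then (if X < a + c then 1 / ((a : ℝ) * c) else 0) else 0)
        = ∑ c ∈ s, (if a.Coprime c then (if X + 1 < a + c then 1 / ((a : ℝ) * c) else 0) else 0)
          + (if a.Coprime (X + 1) then 1 / ((a : ℝ) * (X + 1 - a)) else 0) := by
      intro a ha
      have ha' := Finset.mem_Icc.mp ha
      have hmem : X + 1 - a ∈ s := Finset.mem_Icc.mpr (by omega)
      have h1 : (if a.Coprime (X + 1) then 1 / ((a : ℝ) * (X + 1 - a)) else 0)
          = ∑ c ∈ s, if c = X + 1 - a then (if a.Coprime c then 1 / ((a : ℝ) * c) else 0) else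
              0 := by
        rw [Finset.sum_ite_eq' s (X + 1 - a), if_pos hmem]
        have h2 : a.Coprime (X + 1 - a) ↔ a.Coprime (X + 1) := by
          rw [Nat.coprime_sub_self_right (by omega)]
        simp only [h2]
        rw [Nat.cast_sub (by omega)]
        push_cast
        rfl
      rw [h1, ← Finset.sum_add_distrib]
      refine Finset.sum_congr rfl fun c _ => ?_
      by_cases hc : c = X + 1 - a
      · have e1 : X < a + c := by omega
        have e2 : ¬ X + 1 < a + c := by omega
        simp only [if_pos hc, if_pos e1, if_neg e2, ite_self, zero_add]
      · have e1 : X < a + c ↔ X + 1 < a + c := by omega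
        simp only [if_neg hc, e1, add_zero]
    rw [Finset.sum_congr rfl hsplit, Finset.sum_add_distrib] at ih
    have hlost : ∑ a ∈ s, (if a.Coprime (X + 1) then 1 / ((a : ℝ) * (X + 1 - a)) else 0)
        = 2 * ∑ a ∈ s, (if a.Coprime (X + 1) then 1 / (a : ℝ) else 0) / ((X : ℝ) + 1) := by
      have h1 : ∀ a ∈ s, (if a.Coprime (X + 1) then 1 / ((a : ℝ) * (X + 1 - a)) else 0)
          = (if a.Coprime (X + 1) then 1 / (a : ℝ) else 0) / ((X : ℝ) + 1)
            + (if (X + 1 - a).Coprime (X + 1) then 1 / ((X + 1 - a : ℕ) : ℝ) else 0) / ((X : ℝ)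
                + 1) := by
        intro a ha
        have ha' := Finset.mem_Icc.mp ha
        have h2 : (X + 1 - a).Coprime (X + 1) ↔ a.Coprime (X + 1) :=
          Nat.coprime_self_sub_left (by omega)
        simp only [h2]
        split_ifs
        · have p1 : (a : ℝ) ≠ 0 := by exact_mod_cast (by omega : a ≠ 0)
          have p2 : ((X : ℝ) + 1 - a) ≠ 0 := by
            have : (a : ℝ) ≤ X := by exact_mod_cast ha'.2
            linarith
          have p3 : (X : ℝ) + 1 ≠ 0 := by positivity
          rw [Nat.cast_sub (by omega)]
          push_cast
          field_simp
          ring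
        · simp
      rw [Finset.sum_congr rfl h1, Finset.sum_add_distrib, two_mul]
      congr 1
      refine Finset.sum_nbij' (fun a => X + 1 - a) (fun a => X + 1 - a) ?_ ?_ ?_ ?_ ?_
      · intro a ha
        have ha' := Finset.mem_Icc.mp ha
        exact Finset.mem_Icc.mpr (by omega)
      · intro a ha
        have ha' := Finset.mem_Icc.mp ha
        exact Finset.mem_Icc.mpr (by omega)
      · intro a ha
        have ha' := Finset.mem_Icc.mp ha
        omega
      · intro a ha
        have ha' := Finset.mem_Icc.mp ha
        omega
      · intro a _
        rfl
    rw [hlost] at ih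
    rw [hIcc, Finset.sum_insert hnot, Finset.sum_insert hnot]
    simp only [Finset.sum_insert hnot]
    rw [Finset.sum_add_distrib, Finset.sum_congr rfl hnew, Finset.sum_congr rfl hnew', if_neg hself]
    linarith

theorem finsum_units_const {a : ℕ} [NeZero a] (r : ℝ) :
    ∑ᶠ _u : (ZMod a)ˣ, r = a.totient * r := by
  rw [finsum_eq_sum_of_fintype, Finset.sum_const, Finset.card_univ, ZMod.card_units_eq_totient,
    nsmul_eq_mul]

theorem sum_coprimePairs_max (X : ℕ) :
    ∑ p ∈ coprimePairs X, max 0 ((p.1 : ℝ) + p.2 - X) / (p.1 * p.2)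
      = 2 * ∑ a ∈ Finset.Icc 1 X, (a.totient : ℝ) / a - X := by
  rcases Nat.eq_zero_or_pos X with rfl | hX
  · simp [coprimePairs]
  have h1 : ∀ p ∈ coprimePairs X, max 0 ((p.1 : ℝ) + p.2 - X) / (p.1 * p.2)
      = (if X < p.1 + p.2 then 1 / (p.1 : ℝ) else 0)
        + (if X < p.swap.1 + p.swap.2 then 1 / (p.swap.1 : ℝ) else 0)
        - X * (if X < p.1 + p.2 then 1 / ((p.1 : ℝ) * p.2) else 0) := by
    intro p hp
    have hp' := mem_coprimePairs.mp hp
    have q1 : (p.1 : ℝ) ≠ 0 := by exact_mod_cast (by omega : p.1 ≠ 0)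
    have q2 : (p.2 : ℝ) ≠ 0 := by exact_mod_cast (by omega : p.2 ≠ 0)
    by_cases hlt : X < p.1 + p.2
    · have hlt' : (X : ℝ) < p.1 + p.2 := by exact_mod_cast hlt
      have hlt2 : X < p.swap.1 + p.swap.2 := by simp; omega
      rw [max_eq_right (by linarith), if_pos hlt, if_pos hlt2, if_pos hlt]
      simp only [Prod.fst_swap]
      field_simp
      ring
    · have hlt' : (p.1 : ℝ) + p.2 ≤ X := by exact_mod_cast not_lt.mp hlt
      have hlt2 : ¬ X < p.swap.1 + p.swap.2 := by simp; omega
      rw [max_eq_left (by linarith), if_neg hlt, if_neg hlt2, if_neg hlt]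
      simp
  have h2 : ∑ p ∈ coprimePairs X, (if X < p.1 + p.2 then 1 / (p.1 : ℝ) else 0)
      = ∑ a ∈ Finset.Icc 1 X, (a.totient : ℝ) / a := by
    rw [sum_coprimePairs_corner X (fun a _ => 1 / (a : ℝ))]
    refine Finset.sum_congr rfl fun a ha => ?_
    have : NeZero a := ⟨by have := (Finset.mem_Icc.mp ha).1; omega⟩
    rw [finsum_units_const]
    ring
  rw [Finset.sum_congr rfl h1, Finset.sum_sub_distrib, Finset.sum_add_distrib,
    sum_coprimePairs_swap X (fun p => if X < p.1 + p.2 then 1 / (p.1 : ℝ) else 0), h2,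
    ← Finset.mul_sum, sum_coprimePairs_corner_inv_mul hX]
  ring

/-! ### Solutions with a coprime pair of coefficients -/

theorem sum_coprimePairs_inv_mul_le (X : ℕ) :
    ∑ p ∈ coprimePairs X, 1 / ((p.1 : ℝ) * p.2) ≤ ((harmonic X : ℚ) : ℝ) ^ 2 := by
  calc _ ≤ ∑ p ∈ Finset.Icc 1 X ×ˢ Finset.Icc 1 X, 1 / ((p.1 : ℝ) * p.2) :=
        Finset.sum_le_sum_of_subset_of_nonneg (Finset.filter_subset _ _)
          fun _ _ _ => by positivity
    _ = _ := by
        rw [harmonic_eq_sum_one_div, sq, Finset.sum_mul_sum, Finset.sum_product]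
        refine Finset.sum_congr rfl fun a _ => Finset.sum_congr rfl fun c _ => ?_
        rw [div_mul_div_comm, one_mul]

/-- Swapping `a` and `c` exchanges the two sawtooth terms of `lineCount_eq`, so only one is kept. -/
theorem sum_coprimePairs_lineCount_eq (h N X : ℕ) :
    ∑ p ∈ coprimePairs X, (lineCount h N p.1 p.2 : ℝ)
      = ∑ p ∈ coprimePairs X, max 0 ((N : ℝ) * (p.1 + p.2) - h) / (p.1 * p.2)
        + ∑ p ∈ coprimePairs X, (if h ≤ N * (p.1 + p.2) then lineSawtooth h N p.1 p.2 else 0) := by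
  set g : ℕ × ℕ → ℝ := fun p => if h ≤ N * (p.1 + p.2) then lineSawtooth h N p.1 p.2 else 0 with hg
  have h1 : ∀ p ∈ coprimePairs X, (lineCount h N p.1 p.2 : ℝ)
      = max 0 ((N : ℝ) * (p.1 + p.2) - h) / (p.1 * p.2) + (g p + g p.swap) / 2 := by
    intro p hp
    have hp' := mem_coprimePairs.mp hp
    simp only [hg, Prod.fst_swap, Prod.snd_swap, add_comm p.2 p.1]
    by_cases hle : h ≤ N * (p.1 + p.2)
    · have hle' : (h : ℝ) ≤ N * (p.1 + p.2) := by exact_mod_cast hle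
      rw [if_pos hle, if_pos hle, max_eq_right (by linarith),
        lineCount_eq hp'.1.1.1 hp'.1.2.1 hp'.2 hle]
    · have hlt' : (N : ℝ) * (p.1 + p.2) < h := by exact_mod_cast not_le.mp hle
      rw [if_neg hle, if_neg hle, max_eq_left (by linarith), lineCount_eq_zero (not_le.mp hle)]
      simp
  rw [Finset.sum_congr rfl h1, Finset.sum_add_distrib, ← Finset.sum_div, Finset.sum_add_distrib,
    sum_coprimePairs_swap]
  ring

theorem abs_sum_max_sub_le (h N X : ℕ) :
    |∑ p ∈ coprimePairs X, max 0 ((N : ℝ) * (p.1 + p.2) - h) / (p.1 * p.2)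
        - N * (2 * ∑ a ∈ Finset.Icc 1 X, (a.totient : ℝ) / a - X)|
      ≤ |(h : ℝ) - N * X| * ((harmonic X : ℚ) : ℝ) ^ 2 := by
  rw [← sum_coprimePairs_max, Finset.mul_sum, ← Finset.sum_sub_distrib]
  refine (Finset.abs_sum_le_sum_abs _ _).trans ?_
  refine le_trans ?_ (mul_le_mul_of_nonneg_left (sum_coprimePairs_inv_mul_le X) (abs_nonneg _))
  rw [Finset.mul_sum]
  refine Finset.sum_le_sum fun p _ => ?_
  have e : max 0 ((N : ℝ) * (p.1 + p.2) - h) / (p.1 * p.2)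
      - N * (max 0 ((p.1 : ℝ) + p.2 - X) / (p.1 * p.2))
      = (max 0 ((N : ℝ) * (p.1 + p.2) - h) - max 0 (N * ((p.1 : ℝ) + p.2 - X)))
        * (1 / ((p.1 : ℝ) * p.2)) := by
    have := mul_max_of_nonneg 0 ((p.1 : ℝ) + p.2 - X) (Nat.cast_nonneg (α := ℝ) N)
    rw [mul_zero] at this
    rw [← this]
    ring
  rw [e, abs_mul, abs_of_nonneg (by positivity : (0 : ℝ) ≤ 1 / ((p.1 : ℝ) * p.2))]
  refine mul_le_mul_of_nonneg_right ?_ (by positivity)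
  refine (abs_max_sub_max_le_max _ _ _ _).trans ?_
  rw [sub_self, abs_zero, max_eq_right (abs_nonneg _), ← abs_neg]
  apply le_of_eq
  congr 1
  ring

/-- The conditions `h ≤ N (a + c)` and `a + c > X` disagree only if `a + c` is within
`|h - N X| / N` of `X`. -/
theorem card_region_diff_le {h N X : ℕ} (hN : 1 ≤ N) (a : ℕ) :
    (((Finset.Icc 1 X).filter fun c => ¬ (h ≤ N * (a + c) ↔ X < a + c)).card : ℝ)
      ≤ 2 * (|(h : ℝ) - N * X| / N) + 1 := by
  obtain ⟨e, he⟩ : ∃ e : ℕ, e = ((h : ℤ) - N * X).natAbs / N := ⟨_, rfl⟩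
  have hsub : ((Finset.Icc 1 X).filter fun c => ¬ (h ≤ N * (a + c) ↔ X < a + c))
      ⊆ Finset.Icc (X - a - e) (X + e - a) := by
    intro c hc
    rw [Finset.mem_filter] at hc
    have hne := hc.2
    have hdist : X ≤ a + c + e ∧ a + c ≤ X + e := by
      by_cases hlt : X < a + c
      · have h1 : N * (a + c) < h := by
          by_contra hcon
          exact hne ⟨fun _ => hlt, fun _ => not_lt.mp hcon⟩
        refine ⟨by omega, ?_⟩
        have : a + c - X ≤ e := by
          rw [he, Nat.le_div_iff_mul_le hN]
          zify [hlt.le]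
          refine le_trans ?_ (le_abs_self _)
          zify at h1
          linarith
        omega
      · have h1 : h ≤ N * (a + c) := by
          by_contra hcon
          exact hne ⟨fun h => absurd h hcon, fun h => absurd h hlt⟩
        refine ⟨?_, by omega⟩
        have : X - (a + c) ≤ e := by
          rw [he, Nat.le_div_iff_mul_le hN]
          have h2 : a + c ≤ X := not_lt.mp hlt
          zify [h2]
          refine le_trans ?_ (neg_le_abs _)
          zify at h1
          linarith
        omega
    rw [Finset.mem_Icc]
    omega
  have hcard := Finset.card_le_card hsub
  rw [Nat.card_Icc] at hcard
  have h2 : X + e - a + 1 - (X - a - e) ≤ 2 * e + 1 := by omega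
  have h3 : (e : ℝ) ≤ |(h : ℝ) - N * X| / N := by
    rw [he]
    refine Nat.cast_div_le.trans (le_of_eq ?_)
    rw [Nat.cast_natAbs]
    push_cast
    rfl
  calc _ ≤ ((2 * e + 1 : ℕ) : ℝ) := by exact_mod_cast hcard.trans h2
    _ ≤ _ := by push_cast; linarith

theorem abs_sum_lineSawtooth_sub_corner_le {h N X : ℕ} (hN : 1 ≤ N) :
    |∑ p ∈ coprimePairs X, (if h ≤ N * (p.1 + p.2) then lineSawtooth h N p.1 p.2 else 0)
        - ∑ p ∈ coprimePairs X, (if X < p.1 + p.2 then lineSawtooth h N p.1 p.2 else 0)|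
      ≤ X * (2 * (|(h : ℝ) - N * X| / N) + 1) := by
  rw [← Finset.sum_sub_distrib]
  refine (Finset.abs_sum_le_sum_abs _ _).trans ?_
  calc _ ≤ ∑ p ∈ coprimePairs X,
      (if ¬ (h ≤ N * (p.1 + p.2) ↔ X < p.1 + p.2) then (1 : ℝ) else 0) := by
        refine Finset.sum_le_sum fun p hp => ?_
        have hp' := mem_coprimePairs.mp hp
        have : NeZero p.1 := ⟨by omega⟩
        have hb : |lineSawtooth h N p.1 p.2| ≤ 1 := abs_sawtooth_le_one _
        by_cases h1 : h ≤ N * (p.1 + p.2) <;> by_cases h2 : X < p.1 + p.2 <;> simp [h1, h2, hb]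
    _ ≤ ∑ p ∈ Finset.Icc 1 X ×ˢ Finset.Icc 1 X,
          (if ¬ (h ≤ N * (p.1 + p.2) ↔ X < p.1 + p.2) then (1 : ℝ) else 0) :=
        Finset.sum_le_sum_of_subset_of_nonneg (Finset.filter_subset _ _)
          fun _ _ _ => by positivity
    _ = ∑ a ∈ Finset.Icc 1 X,
          (((Finset.Icc 1 X).filter fun c => ¬ (h ≤ N * (a + c) ↔ X < a + c)).card : ℝ) := by
        rw [Finset.sum_product]
        refine Finset.sum_congr rfl fun a _ => ?_
        rw [Finset.sum_boole]
    _ ≤ ∑ a ∈ Finset.Icc 1 X, (2 * (|(h : ℝ) - N * X| / N) + 1) :=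
        Finset.sum_le_sum fun a _ => card_region_diff_le hN a
    _ = _ := by
        rw [Finset.sum_const, Nat.card_Icc, nsmul_eq_mul]
        simp

theorem abs_sum_corner_lineSawtooth_le (h N X : ℕ) :
    |∑ p ∈ coprimePairs X, (if X < p.1 + p.2 then lineSawtooth h N p.1 p.2 else 0)|
      ≤ ∑ a ∈ Finset.Icc 1 X, (a.divisors.card : ℝ) * Nat.gcd h a := by
  have h1 := sum_coprimePairs_corner X (fun a z => sawtooth a ((N : ZMod a) - h * z⁻¹))
  simp only [lineSawtooth]
  rw [h1]
  refine (Finset.abs_sum_le_sum_abs _ _).trans (Finset.sum_le_sum fun a ha => ?_)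
  have : NeZero a := ⟨by have := (Finset.mem_Icc.mp ha).1; omega⟩
  rw [finsum_eq_sum_of_fintype]
  have h2 : ∑ u : (ZMod a)ˣ, sawtooth a ((N : ZMod a) - h * (u : ZMod a)⁻¹)
      = ∑ u : (ZMod a)ˣ, sawtooth a (((N : ℤ) : ZMod a) - h * (u : ZMod a)) := by
    rw [← (Equiv.inv (ZMod a)ˣ).bijective.sum_comp]
    refine Finset.sum_congr rfl fun u _ => ?_
    simp
  rw [h2]
  exact abs_sum_units_sawtooth_le a h N

/-- The count of solutions of `a x + c y + h = N (a + c)` with `a, c ≤ X` coprime. The main term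
comes from the Farey identity; at the corner `a + c > X` the fractional parts are summed over
complete residue systems and cancel. -/
theorem abs_sum_coprimePairs_lineCount_sub_le {h N : ℕ} (hN : 1 ≤ N) (X : ℕ) :
    |∑ p ∈ coprimePairs X, (lineCount h N p.1 p.2 : ℝ)
        - N * (2 * ∑ a ∈ Finset.Icc 1 X, (a.totient : ℝ) / a - X)|
      ≤ |(h : ℝ) - N * X| * ((harmonic X : ℚ) : ℝ) ^ 2
        + X * (2 * (|(h : ℝ) - N * X| / N) + 1)
        + ∑ a ∈ Finset.Icc 1 X, (a.divisors.card : ℝ) * Nat.gcd h a := by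
  rw [sum_coprimePairs_lineCount_eq]
  have h1 := abs_le.mp (abs_sum_max_sub_le h N X)
  have h2 := abs_le.mp (abs_sum_lineSawtooth_sub_corner_le (h := h) (X := X) hN)
  have h3 := abs_le.mp (abs_sum_corner_lineSawtooth_le h N X)
  rw [abs_le]
  constructor <;> linarith [h1.1, h1.2, h2.1, h2.2, h3.1, h3.2]

/-! ### Grouping the coefficient pairs by their greatest common divisor -/

theorem lineCount_mul_left {g h N a c : ℕ} (hg : 0 < g) (ha : 0 < a) (hc : 0 < c) :
    lineCount (g * h) N (g * a) (g * c) = lineCount h N a c := by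
  have hiff : ∀ x y : ℕ, g * a * x + g * c * y + g * h = N * (g * a + g * c)
      ↔ a * x + c * y + h = N * (a + c) := by
    intro x y
    have e1 : g * a * x + g * c * y + g * h = g * (a * x + c * y + h) := by ring
    have e2 : N * (g * a + g * c) = g * (N * (a + c)) := by ring
    rw [e1, e2]
    exact Nat.mul_right_inj hg.ne'
  have hle : N * (a + c) ≤ N * (g * a + g * c) :=
    Nat.mul_le_mul_left N (add_le_add (Nat.le_mul_of_pos_left a hg) (Nat.le_mul_of_pos_left c hg))
  rw [lineCount, lineCount]
  congr 1
  ext ⟨x, y⟩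
  simp only [Finset.mem_filter, Finset.mem_product, Finset.mem_range, hiff]
  refine ⟨fun ⟨_, he⟩ => ⟨?_, he⟩, fun ⟨_, he⟩ => ⟨?_, he⟩⟩ <;>
  · have h1 := Nat.le_mul_of_pos_left x ha
    have h2 := Nat.le_mul_of_pos_left y hc
    constructor <;> omega

theorem lineCount_eq_zero_of_not_dvd {h N a c : ℕ} (hd : ¬ Nat.gcd a c ∣ h) :
    lineCount h N a c = 0 := by
  rw [lineCount, Finset.card_eq_zero, Finset.filter_eq_empty_iff]
  intro p _ he
  apply hd
  have h1 : Nat.gcd a c ∣ a * p.1 + c * p.2 :=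
    dvd_add ((Nat.gcd_dvd_left a c).mul_right _) ((Nat.gcd_dvd_right a c).mul_right _)
  have h2 : Nat.gcd a c ∣ N * (a + c) :=
    (dvd_add (Nat.gcd_dvd_left a c) (Nat.gcd_dvd_right a c)).mul_left _
  rw [← he] at h2
  exact (Nat.dvd_add_right h1).mp h2

theorem sum_lineCount_eq_sum_divisors {h : ℕ} (hh : h ≠ 0) (N : ℕ) :
    ∑ p ∈ Finset.Icc 1 N ×ˢ Finset.Icc 1 N, (lineCount h N p.1 p.2 : ℝ)
      = ∑ g ∈ h.divisors, ∑ p ∈ coprimePairs (N / g), (lineCount (h / g) N p.1 p.2 : ℝ) := by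
  have h1 : ∑ p ∈ Finset.Icc 1 N ×ˢ Finset.Icc 1 N, (lineCount h N p.1 p.2 : ℝ)
      = ∑ p ∈ (Finset.Icc 1 N ×ˢ Finset.Icc 1 N).filter (fun p => Nat.gcd p.1 p.2 ∣ h),
        (lineCount h N p.1 p.2 : ℝ) := by
    symm
    refine Finset.sum_subset (Finset.filter_subset _ _) fun p hp hp' => ?_
    rw [lineCount_eq_zero_of_not_dvd fun hd => hp' (Finset.mem_filter.mpr ⟨hp, hd⟩), Nat.cast_zero]
  rw [h1, Finset.sum_sigma']
  symm
  refine Finset.sum_bij (fun q _ => (q.1 * q.2.1, q.1 * q.2.2)) ?_ ?_ ?_ ?_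
  · rintro ⟨g, a, c⟩ hq
    simp only [Finset.mem_sigma, mem_coprimePairs, Nat.mem_divisors] at hq
    obtain ⟨⟨hg, -⟩, ⟨⟨ha1, ha2⟩, hc1, hc2⟩, hcop⟩ := hq
    have hg0 : 0 < g := Nat.pos_of_dvd_of_pos hg (Nat.pos_of_ne_zero hh)
    simp only [Finset.mem_filter, Finset.mem_product, Finset.mem_Icc]
    rw [Nat.gcd_mul_left, hcop, mul_one]
    refine ⟨⟨⟨Nat.mul_pos hg0 ha1, ?_⟩, Nat.mul_pos hg0 hc1, ?_⟩, hg⟩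
    · rw [mul_comm]; exact (Nat.le_div_iff_mul_le hg0).mp ha2
    · rw [mul_comm]; exact (Nat.le_div_iff_mul_le hg0).mp hc2
  · rintro ⟨g, a, c⟩ hq ⟨g', a', c'⟩ hq' heq
    simp only [Finset.mem_sigma, mem_coprimePairs, Nat.mem_divisors] at hq hq'
    obtain ⟨⟨hg, -⟩, -, hcop⟩ := hq
    obtain ⟨-, -, hcop'⟩ := hq'
    have hg0 : 0 < g := Nat.pos_of_dvd_of_pos hg (Nat.pos_of_ne_zero hh)
    obtain ⟨e1, e2⟩ := Prod.mk.inj heq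
    have hgg : g = g' := by
      have : Nat.gcd (g * a) (g * c) = Nat.gcd (g' * a') (g' * c') := by rw [e1, e2]
      rwa [Nat.gcd_mul_left, Nat.gcd_mul_left, hcop, hcop', mul_one, mul_one] at this
    subst hgg
    have e3 := Nat.eq_of_mul_eq_mul_left hg0 e1
    have e4 := Nat.eq_of_mul_eq_mul_left hg0 e2
    subst e3 e4
    rfl
  · rintro ⟨a, c⟩ hp
    simp only [Finset.mem_filter, Finset.mem_product, Finset.mem_Icc] at hp
    obtain ⟨⟨⟨ha1, ha2⟩, hc1, hc2⟩, hd⟩ := hp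
    have hg0 : 0 < Nat.gcd a c := Nat.gcd_pos_of_pos_left _ ha1
    have ea := Nat.mul_div_cancel' (Nat.gcd_dvd_left a c)
    have ec := Nat.mul_div_cancel' (Nat.gcd_dvd_right a c)
    refine ⟨⟨Nat.gcd a c, a / Nat.gcd a c, c / Nat.gcd a c⟩, ?_, by simp [ea, ec]⟩
    simp only [Finset.mem_sigma, mem_coprimePairs, Nat.mem_divisors]
    exact ⟨⟨hd, hh⟩, ⟨⟨Nat.div_pos (Nat.le_of_dvd ha1 (Nat.gcd_dvd_left a c)) hg0,
      Nat.div_le_div_right ha2⟩, Nat.div_pos (Nat.le_of_dvd hc1 (Nat.gcd_dvd_right a c)) hg0,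
      Nat.div_le_div_right hc2⟩, Nat.coprime_div_gcd_div_gcd hg0⟩
  · rintro ⟨g, a, c⟩ hq
    simp only [Finset.mem_sigma, mem_coprimePairs, Nat.mem_divisors] at hq
    obtain ⟨⟨⟨k, rfl⟩, -⟩, ⟨⟨ha1, -⟩, hc1, -⟩, -⟩ := hq
    have hg0 : 0 < g := Nat.pos_of_ne_zero fun h0 => hh (by rw [h0, zero_mul])
    rw [Nat.mul_div_cancel_left k hg0, lineCount_mul_left hg0 ha1 hc1]

/-! ### Reduction of the determinant equation to positive coefficients -/

/-- The number of `(u, v) ∈ [-N, N]²` with `α v - β u = h`. -/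
noncomputable def rowCount (h N : ℕ) (α β : ℤ) : ℕ :=
  ((Finset.Icc (-(N : ℤ)) N ×ˢ Finset.Icc (-(N : ℤ)) N).filter
    fun p => α * p.2 - β * p.1 = (h : ℤ)).card

theorem solutionCount_eq_sum_rowCount (h N : ℕ) :
    solutionCount h N
      = ∑ α ∈ Finset.Icc (-(N : ℤ)) N, ∑ β ∈ Finset.Icc (-(N : ℤ)) N, rowCount h N α β := by
  set J := Finset.Icc (-(N : ℤ)) N with hJ
  have h1 : solutionCount h N = (((J ×ˢ J) ×ˢ (J ×ˢ J)).filter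
      fun p => p.1.1 * p.2.2 - p.1.2 * p.2.1 = (h : ℤ)).card := by
    rw [solutionCount]
    refine Finset.card_nbij' (fun x => ((x 0, x 1), (x 2, x 3)))
      (fun p => ![p.1.1, p.1.2, p.2.1, p.2.2]) ?_ ?_ ?_ ?_
    · intro x hx
      simp only [Finset.coe_filter, Set.mem_ofPred_eq, Fintype.mem_piFinset,
          Finset.mem_product] at hx ⊢
      exact ⟨⟨⟨hx.1 0, hx.1 1⟩, hx.1 2, hx.1 3⟩, hx.2⟩
    · intro p hp
      simp only [Finset.coe_filter, Set.mem_ofPred_eq, Fintype.mem_piFinset,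
          Finset.mem_product] at hp ⊢
      refine ⟨fun i => ?_, hp.2⟩
      fin_cases i
      · exact hp.1.1.1
      · exact hp.1.1.2
      · exact hp.1.2.1
      · exact hp.1.2.2
    · intro x _
      ext i
      fin_cases i <;> rfl
    · intro p _
      rfl
  rw [h1, Finset.card_filter, Finset.sum_product, Finset.sum_product]
  refine Finset.sum_congr rfl fun α _ => Finset.sum_congr rfl fun β _ => ?_
  rw [rowCount, Finset.card_filter]

theorem rowCount_neg_left (h N : ℕ) (α β : ℤ) : rowCount h N (-α) β = rowCount h N α β := by
  refine Finset.card_nbij' (fun p => (p.1, -p.2)) (fun p => (p.1, -p.2)) ?_ ?_ ?_ ?_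
  · intro p hp
    simp only [Finset.coe_filter, Set.mem_ofPred_eq, Finset.mem_product, Finset.mem_Icc] at hp ⊢
    exact ⟨⟨hp.1.1, by omega⟩, by linarith [hp.2]⟩
  · intro p hp
    simp only [Finset.coe_filter, Set.mem_ofPred_eq, Finset.mem_product, Finset.mem_Icc] at hp ⊢
    exact ⟨⟨hp.1.1, by omega⟩, by linarith [hp.2]⟩
  · intro p _
    simp
  · intro p _
    simp

theorem rowCount_neg_right (h N : ℕ) (α β : ℤ) : rowCount h N α (-β) = rowCount h N α β := by
  refine Finset.card_nbij' (fun p => (-p.1, p.2)) (fun p => (-p.1, p.2)) ?_ ?_ ?_ ?_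
  · intro p hp
    simp only [Finset.coe_filter, Set.mem_ofPred_eq, Finset.mem_product, Finset.mem_Icc] at hp ⊢
    exact ⟨⟨by omega, hp.1.2⟩, by linarith [hp.2]⟩
  · intro p hp
    simp only [Finset.coe_filter, Set.mem_ofPred_eq, Finset.mem_product, Finset.mem_Icc] at hp ⊢
    exact ⟨⟨by omega, hp.1.2⟩, by linarith [hp.2]⟩
  · intro p _
    simp
  · intro p _
    simp

theorem sum_Icc_neg_of_even {f : ℤ → ℕ} (hf : ∀ t, f (-t) = f t) (N : ℕ) :
    ∑ t ∈ Finset.Icc (-(N : ℤ)) N, f t = f 0 + 2 * ∑ a ∈ Finset.Icc 1 N, f (a : ℤ) := by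
  induction N with
  | zero => simp
  | succ N ih =>
    have h1 : Finset.Icc (-((N + 1 : ℕ) : ℤ)) ((N + 1 : ℕ) : ℤ)
        = insert (((N + 1 : ℕ) : ℤ)) (insert (-((N + 1 : ℕ) : ℤ)) (Finset.Icc (-(N : ℤ)) N)) := by
      ext t
      simp only [Finset.mem_insert, Finset.mem_Icc]
      omega
    have h2 : Finset.Icc 1 (N + 1) = insert (N + 1) (Finset.Icc 1 N) := by
      ext t
      simp only [Finset.mem_insert, Finset.mem_Icc]
      omega
    rw [h1, h2, Finset.sum_insert, Finset.sum_insert, Finset.sum_insert, ih, hf]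
    · ring
    · simp
    · simp only [Finset.mem_Icc]; omega
    · simp only [Finset.mem_insert, Finset.mem_Icc]; omega

theorem solutionCount_eq {h : ℕ} (hh : h ≠ 0) (N : ℕ) :
    solutionCount h N
      = 2 * ∑ c ∈ Finset.Icc 1 N, rowCount h N 0 c + 2 * ∑ a ∈ Finset.Icc 1 N, rowCount h N a 0
        + 4 * ∑ p ∈ Finset.Icc 1 N ×ˢ Finset.Icc 1 N, rowCount h N p.1 p.2 := by
  have h0 : rowCount h N 0 0 = 0 := by
    rw [rowCount, Finset.card_eq_zero, Finset.filter_eq_empty_iff]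
    intro p _
    simp only [zero_mul, sub_zero]
    exact_mod_cast hh.symm
  have hinner : ∀ α : ℤ, ∑ β ∈ Finset.Icc (-(N : ℤ)) N, rowCount h N α β
      = rowCount h N α 0 + 2 * ∑ c ∈ Finset.Icc 1 N, rowCount h N α c :=
    fun α => sum_Icc_neg_of_even (fun β => rowCount_neg_right h N α β) N
  rw [solutionCount_eq_sum_rowCount,
      sum_Icc_neg_of_even (fun α => by simp only [rowCount_neg_left]) N]
  simp only [hinner]
  rw [Finset.sum_add_distrib, ← Finset.mul_sum, h0, Finset.sum_product]
  ring

theorem rowCount_zero_left_le {h N c : ℕ} (hc : 0 < c) :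
    rowCount h N 0 c ≤ if c ∣ h then 2 * N + 1 else 0 := by
  split_ifs with hd
  · have hsub : ((Finset.Icc (-(N : ℤ)) N ×ˢ Finset.Icc (-(N : ℤ)) N).filter
        fun p => 0 * p.2 - (c : ℤ) * p.1 = (h : ℤ))
        ⊆ (Finset.Icc (-(N : ℤ)) N).image (fun v => (-((h : ℤ) / c), v)) := by
      rintro ⟨u, v⟩ hp
      simp only [Finset.mem_filter, Finset.mem_product] at hp
      refine Finset.mem_image.mpr ⟨v, hp.1.2, ?_⟩
      have : (h : ℤ) = c * (-u) := by linarith [hp.2]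
      rw [this, Int.mul_ediv_cancel_left _ (by exact_mod_cast hc.ne'), neg_neg]
    refine (Finset.card_le_card hsub).trans (Finset.card_image_le.trans ?_)
    rw [Int.card_Icc]
    omega
  · rw [rowCount, Nat.le_zero, Finset.card_eq_zero, Finset.filter_eq_empty_iff]
    intro p _ he
    apply hd
    have : (h : ℤ) = c * (-p.1) := by linarith [he]
    exact_mod_cast Dvd.intro _ this.symm

theorem rowCount_zero_right_eq (h N : ℕ) (a : ℤ) : rowCount h N a 0 = rowCount h N 0 a := by
  refine Finset.card_nbij' (fun p => (-p.2, p.1)) (fun p => (p.2, -p.1)) ?_ ?_ ?_ ?_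
  · intro p hp
    simp only [Finset.coe_filter, Set.mem_ofPred_eq, Finset.mem_product, Finset.mem_Icc] at hp ⊢
    exact ⟨⟨by omega, hp.1.1⟩, by linarith [hp.2]⟩
  · intro p hp
    simp only [Finset.coe_filter, Set.mem_ofPred_eq, Finset.mem_product, Finset.mem_Icc] at hp ⊢
    exact ⟨⟨hp.1.2, by omega⟩, by linarith [hp.2]⟩
  · intro p _
    simp
  · intro p _
    simp

theorem sum_rowCount_zero_le {h : ℕ} (hh : h ≠ 0) (N : ℕ) :
    ∑ c ∈ Finset.Icc 1 N, rowCount h N 0 c ≤ h.divisors.card * (2 * N + 1) := by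
  calc _ ≤ ∑ c ∈ Finset.Icc 1 N, if c ∣ h then 2 * N + 1 else 0 :=
        Finset.sum_le_sum fun c hc => rowCount_zero_left_le (Finset.mem_Icc.mp hc).1
    _ = ((Finset.Icc 1 N).filter (· ∣ h)).card * (2 * N + 1) := by
        rw [← Finset.sum_filter, Finset.sum_const, smul_eq_mul]
    _ ≤ _ := by
        refine Nat.mul_le_mul_right _ (Finset.card_le_card fun d hd => ?_)
        exact Nat.mem_divisors.mpr ⟨(Finset.mem_filter.mp hd).2, hh⟩

/-- The number of points `(x, y) ∈ ℕ²` with `x > N` on the line of `lineCount`. -/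
def lineExcess (h N a c : ℕ) : ℕ :=
  ((Finset.range (N * (a + c) + 1) ×ˢ Finset.range (N * (a + c) + 1)).filter
    fun p => a * p.1 + c * p.2 + h = N * (a + c) ∧ N < p.1).card

/-- The substitution `(u, v) = (N - y, N - x)` embeds the points counted by `rowCount` into the
line; the points that are missed have a large coordinate. -/
theorem rowCount_le_lineCount_le {h N a c : ℕ} (ha : 0 < a) (hc : 0 < c) :
    rowCount h N a c ≤ lineCount h N a c ∧
      lineCount h N a c ≤ rowCount h N a c + (lineExcess h N a c + lineExcess h N c a) := by
  set L := (Finset.range (N * (a + c) + 1) ×ˢ Finset.range (N * (a + c) + 1)).filter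
    fun p => a * p.1 + c * p.2 + h = N * (a + c) with hL
  have h1 : rowCount h N a c = (L.filter fun p => p.1 ≤ 2 * N ∧ p.2 ≤ 2 * N).card := by
    rw [← rowCount_neg_right]
    refine Finset.card_nbij' (fun p => ((N - p.2).toNat, (N - p.1).toNat))
      (fun p => ((N : ℤ) - p.2, (N : ℤ) - p.1)) ?_ ?_ ?_ ?_
    · rintro ⟨u, v⟩ hp
      simp only [Finset.coe_filter, Set.mem_ofPred_eq, Finset.mem_product, Finset.mem_Icc] at hp
      obtain ⟨⟨⟨hu1, hu2⟩, hv1, hv2⟩, he⟩ := hp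
      obtain ⟨x, hx⟩ := Int.eq_ofNat_of_zero_le (sub_nonneg.mpr hv2)
      obtain ⟨y, hy⟩ := Int.eq_ofNat_of_zero_le (sub_nonneg.mpr hu2)
      simp only [hx, hy, Int.toNat_natCast]
      have hline : a * x + c * y + h = N * (a + c) := by
        zify
        rw [← hx, ← hy, ← he]
        ring
      have q1 := Nat.le_mul_of_pos_left x ha
      have q2 := Nat.le_mul_of_pos_left y hc
      simp only [hL, Finset.coe_filter, Set.mem_ofPred_eq, Finset.mem_filter, Finset.mem_product,
        Finset.mem_range]
      refine ⟨⟨⟨by omega, by omega⟩, hline⟩, by omega, by omega⟩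
    · rintro ⟨x, y⟩ hp
      simp only [hL, Finset.coe_filter, Set.mem_ofPred_eq, Finset.mem_filter, Finset.mem_product,
        Finset.mem_range] at hp
      obtain ⟨⟨-, he⟩, hx, hy⟩ := hp
      simp only [Finset.coe_filter, Set.mem_ofPred_eq, Finset.mem_product, Finset.mem_Icc]
      refine ⟨⟨⟨by omega, by omega⟩, by omega, by omega⟩, ?_⟩
      have he' : (a : ℤ) * x + c * y + h = N * (a + c) := by exact_mod_cast he
      linarith
    · rintro ⟨u, v⟩ hp
      simp only [Finset.coe_filter, Set.mem_ofPred_eq, Finset.mem_product, Finset.mem_Icc] at hp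
      refine Prod.ext ?_ ?_ <;> simp only <;> omega
    · rintro ⟨x, y⟩ _
      refine Prod.ext ?_ ?_ <;> simp only <;> omega
  refine ⟨by rw [h1]; exact Finset.card_filter_le _ _, ?_⟩
  have h2 : lineExcess h N c a = (L.filter fun p => N < p.2).card := by
    refine Finset.card_nbij' Prod.swap Prod.swap ?_ ?_ ?_ ?_
    · rintro ⟨x, y⟩ hp
      simp only [hL, Finset.coe_filter, Set.mem_ofPred_eq, Finset.mem_filter, Finset.mem_product,
        Finset.mem_range, Prod.swap, add_comm c a] at hp ⊢
      exact ⟨⟨hp.1.symm, by linarith [hp.2.1]⟩, hp.2.2⟩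
    · rintro ⟨x, y⟩ hp
      simp only [hL, Finset.coe_filter, Set.mem_ofPred_eq, Finset.mem_filter, Finset.mem_product,
        Finset.mem_range, Prod.swap, add_comm c a] at hp ⊢
      exact ⟨hp.1.1.symm, by linarith [hp.1.2], hp.2⟩
    · exact fun p _ => Prod.swap_swap p
    · exact fun p _ => Prod.swap_swap p
  have h3 : lineExcess h N a c = (L.filter fun p => N < p.1).card := by
    rw [lineExcess, hL, Finset.filter_filter]
  rw [h1, h2, h3]
  calc lineCount h N a c = L.card := rfl
    _ ≤ ((L.filter fun p => p.1 ≤ 2 * N ∧ p.2 ≤ 2 * N)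
          ∪ ((L.filter fun p => N < p.1) ∪ (L.filter fun p => N < p.2))).card := by
        refine Finset.card_le_card fun p hp => ?_
        simp only [Finset.mem_union, Finset.mem_filter]
        by_cases q1 : N < p.1
        · exact Or.inr (Or.inl ⟨hp, q1⟩)
        · by_cases q2 : N < p.2
          · exact Or.inr (Or.inr ⟨hp, q2⟩)
          · exact Or.inl ⟨hp, by omega, by omega⟩
    _ ≤ _ := (Finset.card_union_le _ _).trans (Nat.add_le_add_left (Finset.card_union_le _ _) _)

/-- The map `(x, y) ↦ m = a (x - N)` is injective on the points in question, and
`m + h = c (N - y) ≤ N²`. -/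
theorem lineExcess_le {h N a c : ℕ} (ha : 0 < a) (hc : 0 < c) (hcN : c ≤ N) :
    lineExcess h N a c ≤ ((Finset.Icc 1 (N ^ 2 - h)).filter fun m => a ∣ m ∧ c ∣ m + h).card := by
  refine Finset.card_le_card_of_injOn (fun p => a * (p.1 - N)) ?_ ?_
  · rintro ⟨x, y⟩ hp
    simp only [Finset.coe_filter, Set.mem_ofPred_eq] at hp
    obtain ⟨-, he, hlt⟩ := hp
    obtain ⟨k, rfl⟩ := Nat.exists_eq_add_of_lt hlt
    have hk : N + k + 1 - N = k + 1 := by omega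
    have hyN : y ≤ N := by
      by_contra hcon
      have : c * N ≤ c * y := Nat.mul_le_mul_left c (by omega)
      have : 0 < a * (k + 1) := by positivity
      nlinarith
    obtain ⟨l, rfl⟩ := Nat.exists_eq_add_of_le hyN
    have hl : a * (k + 1) + h = c * l := by nlinarith
    have hle : c * l ≤ (y + l) ^ 2 := by
      rw [sq]
      exact Nat.mul_le_mul hcN (by omega)
    simp only [hk, Finset.coe_filter, Set.mem_ofPred_eq, Finset.mem_Icc]
    have : 0 < a * (k + 1) := by positivity
    exact ⟨⟨by omega, by omega⟩, Dvd.intro _ rfl, by rw [hl]; exact Dvd.intro _ rfl⟩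
  · rintro ⟨x, y⟩ hp ⟨x', y'⟩ hp' heq
    simp only [Finset.coe_filter, Set.mem_ofPred_eq] at hp hp'
    obtain ⟨-, he, hlt⟩ := hp
    obtain ⟨-, he', hlt'⟩ := hp'
    have h1 := Nat.eq_of_mul_eq_mul_left ha heq
    have hx : x = x' := by simp only at h1; omega
    subst hx
    have hy : c * y = c * y' := by omega
    rw [Nat.eq_of_mul_eq_mul_left hc hy]

theorem card_filter_dvd_le {n : ℕ} (hn : n ≠ 0) (N : ℕ) :
    ((Finset.Icc 1 N).filter (· ∣ n)).card ≤ n.divisors.card :=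
  Finset.card_le_card fun _ hd => Nat.mem_divisors.mpr ⟨(Finset.mem_filter.mp hd).2, hn⟩

theorem sum_lineExcess_le {h N : ℕ} {K : ℝ}
    (hK : ∀ n : ℕ, n ≠ 0 → n ≤ 2 * N ^ 2 → (n.divisors.card : ℝ) ≤ K) :
    ∑ p ∈ Finset.Icc 1 N ×ˢ Finset.Icc 1 N, (lineExcess h N p.1 p.2 : ℝ)
      ≤ |(h : ℝ) - N ^ 2| * K ^ 2 := by
  have h1 : ∀ p ∈ Finset.Icc 1 N ×ˢ Finset.Icc 1 N, (lineExcess h N p.1 p.2 : ℝ)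
      ≤ ∑ m ∈ Finset.Icc 1 (N ^ 2 - h), (if p.1 ∣ m then 1 else 0)
          * (if p.2 ∣ m + h then (1 : ℝ) else 0) := by
    intro p hp
    simp only [Finset.mem_product, Finset.mem_Icc] at hp
    have := lineExcess_le (h := h) hp.1.1 hp.2.1 hp.2.2
    refine (Nat.cast_le (α := ℝ).mpr this).trans (le_of_eq ?_)
    rw [← Finset.sum_boole]
    refine Finset.sum_congr rfl fun m _ => ?_
    by_cases q1 : p.1 ∣ m <;> by_cases q2 : p.2 ∣ m + h <;> simp [q1, q2]
  refine (Finset.sum_le_sum h1).trans ?_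
  rw [Finset.sum_comm]
  calc _ ≤ ∑ m ∈ Finset.Icc 1 (N ^ 2 - h), K ^ 2 := by
        refine Finset.sum_le_sum fun m hm => ?_
        rw [Finset.mem_Icc] at hm
        rw [Finset.sum_product, ← Finset.sum_mul_sum (Finset.Icc 1 N) (Finset.Icc 1 N)
          (fun a => if a ∣ m then (1 : ℝ) else 0) (fun c => if c ∣ m + h then (1 : ℝ) else 0),
          Finset.sum_boole, Finset.sum_boole, sq]
        have hm0 : m ≠ 0 := by omega
        have b1 := (Nat.cast_le (α := ℝ).mpr (card_filter_dvd_le hm0 N)).trans (hK m hm0 (by omega))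
        have b2 := (Nat.cast_le (α := ℝ).mpr (card_filter_dvd_le (n := m + h) (by omega) N)).trans
          (hK (m + h) (by omega) (by omega))
        exact mul_le_mul b1 b2 (Nat.cast_nonneg _) ((Nat.cast_nonneg _).trans b1)
    _ = ((N ^ 2 - h : ℕ) : ℝ) * K ^ 2 := by
        rw [Finset.sum_const, Nat.card_Icc, nsmul_eq_mul]
        simp
    _ ≤ _ := by
        refine mul_le_mul_of_nonneg_right ?_ (sq_nonneg K)
        rcases le_total h (N ^ 2) with hle | hle
        · rw [Nat.cast_sub hle, abs_sub_comm]
          push_cast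
          exact le_abs_self _
        · rw [Nat.sub_eq_zero_of_le hle]
          simp

theorem abs_solutionCount_sub_le {h N : ℕ} (hh : h ≠ 0) (hhN : h ≤ 2 * N ^ 2) {K : ℝ}
    (hK : ∀ n : ℕ, n ≠ 0 → n ≤ 2 * N ^ 2 → (n.divisors.card : ℝ) ≤ K) :
    |(solutionCount h N : ℝ)
        - 4 * ∑ p ∈ Finset.Icc 1 N ×ˢ Finset.Icc 1 N, (lineCount h N p.1 p.2 : ℝ)|
      ≤ 4 * (K * (2 * N + 1)) + 8 * (|(h : ℝ) - N ^ 2| * K ^ 2) := by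
  set S := Finset.Icc 1 N ×ˢ Finset.Icc 1 N with hS
  have e1 : (solutionCount h N : ℝ) = 4 * ∑ c ∈ Finset.Icc 1 N, (rowCount h N 0 c : ℝ)
      + 4 * ∑ p ∈ S, (rowCount h N p.1 p.2 : ℝ) := by
    rw [solutionCount_eq hh]
    simp only [rowCount_zero_right_eq]
    push_cast
    ring
  have e2 : ∑ c ∈ Finset.Icc 1 N, (rowCount h N 0 c : ℝ) ≤ K * (2 * N + 1) := by
    have := (Nat.cast_le (α := ℝ).mpr (sum_rowCount_zero_le hh N))
    push_cast at this
    exact this.trans (mul_le_mul_of_nonneg_right (hK h hh hhN) (by positivity))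
  have e0 : 0 ≤ ∑ c ∈ Finset.Icc 1 N, (rowCount h N 0 c : ℝ) :=
    Finset.sum_nonneg fun _ _ => Nat.cast_nonneg _
  have hrow : ∀ p ∈ S, (rowCount h N p.1 p.2 : ℝ) ≤ lineCount h N p.1 p.2 ∧
      (lineCount h N p.1 p.2 : ℝ)
        ≤ rowCount h N p.1 p.2 + (lineExcess h N p.1 p.2 + lineExcess h N p.2 p.1) := by
    intro p hp
    simp only [hS, Finset.mem_product, Finset.mem_Icc] at hp
    have := rowCount_le_lineCount_le (h := h) (N := N) hp.1.1 hp.2.1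
    exact_mod_cast this
  have e3 := Finset.sum_le_sum fun p hp => (hrow p hp).1
  have e4 := Finset.sum_le_sum fun p hp => (hrow p hp).2
  rw [Finset.sum_add_distrib, Finset.sum_add_distrib] at e4
  have e5 := sum_lineExcess_le (h := h) hK
  have e6 : ∑ p ∈ S, (lineExcess h N p.2 p.1 : ℝ) = ∑ p ∈ S, (lineExcess h N p.1 p.2 : ℝ) := by
    rw [hS, Finset.sum_product, Finset.sum_comm, ← Finset.sum_product']
  rw [← hS] at e5
  rw [e1, abs_le]
  constructor <;> linarith

/-! ### Assembling the asymptotic formula -/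

/-- The contribution of a single common divisor `g` of the coefficients. -/
theorem abs_sum_coprimePairs_div_sub_le {h N g : ℕ} (hN : 1 ≤ N) (hh : h ≠ 0)
    (hhN : h ≤ 2 * N ^ 2) (hg : g ∣ h) {K : ℝ}
    (hK : ∀ n : ℕ, n ≠ 0 → n ≤ 2 * N ^ 2 → (n.divisors.card : ℝ) ≤ K) :
    |∑ p ∈ coprimePairs (N / g), (lineCount (h / g) N p.1 p.2 : ℝ)
        - (2 / (riemannZeta 2).re - 1) * (1 / g) * (N : ℝ) ^ 2|
      ≤ (9 + |2 / (riemannZeta 2).re - 1|) * (K ^ 2 * ((harmonic N : ℚ) : ℝ) ^ 2)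
        * (N + |(h : ℝ) - N ^ 2|) := by
  set X := N / g with hX
  set H : ℝ := ((harmonic N : ℚ) : ℝ) with hH
  set D : ℝ := |(h : ℝ) - N ^ 2| with hD
  set B : ℝ := |2 / (riemannZeta 2).re - 1| with hB
  set E : ℝ := |((h / g : ℕ) : ℝ) - N * X| with hE
  have hg0 : 0 < g := Nat.pos_of_dvd_of_pos hg (Nat.pos_of_ne_zero hh)
  have hg1 : (1 : ℝ) ≤ g := by exact_mod_cast hg0
  have hN1 : (1 : ℝ) ≤ N := by exact_mod_cast hN
  have hN2 : 1 ≤ 2 * N ^ 2 := by nlinarith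
  have hNN : N ≤ 2 * N ^ 2 := by nlinarith
  have hK1 : 1 ≤ K := by
    have := hK 1 one_ne_zero hN2
    simpa using this
  have hH1 : 1 ≤ H := one_le_harmonic hN
  have hD0 : 0 ≤ D := abs_nonneg _
  have hB0 : 0 ≤ B := abs_nonneg _
  have hXN : X ≤ N := Nat.div_le_self N g
  have hXNr : (X : ℝ) ≤ N := by exact_mod_cast hXN
  have hHX : ((harmonic X : ℚ) : ℝ) ≤ H := harmonic_mono hXN
  have hHX0 : 0 ≤ ((harmonic X : ℚ) : ℝ) := by
    rw [harmonic_eq_sum_one_div]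
    positivity
  have hfl := abs_natCast_div_sub_le N g
  rw [← hX] at hfl
  have hED : E ≤ D + N := by
    have e : ((h / g : ℕ) : ℝ) - N * X = ((h : ℝ) - N ^ 2) / g - N * (X - (N : ℝ) / g) := by
      rw [Nat.cast_div hg (by positivity)]
      ring
    rw [hE, e]
    refine (abs_sub _ _).trans (add_le_add ?_ ?_)
    · rw [abs_div, abs_of_pos (by linarith : (0 : ℝ) < g)]
      exact div_le_self hD0 hg1
    · rw [abs_mul, abs_of_nonneg (by linarith : (0 : ℝ) ≤ N)]
      calc (N : ℝ) * |(X : ℝ) - (N : ℝ) / g| ≤ N * 1 := by gcongr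
        _ = N := mul_one _
  have hE0 : 0 ≤ E := abs_nonneg _
  have m1 := abs_sum_coprimePairs_lineCount_sub_le (h := h / g) hN X
  rw [← hE] at m1
  have b1 : E * ((harmonic X : ℚ) : ℝ) ^ 2 ≤ (D + N) * H ^ 2 := by gcongr
  have b2 : (X : ℝ) * (2 * (E / N) + 1) ≤ 2 * D + 3 * N := by
    calc (X : ℝ) * (2 * (E / N) + 1) ≤ N * (2 * (E / N) + 1) := by gcongr
      _ = 2 * E + N := by field_simp
      _ ≤ _ := by linarith
  have b3 : ∑ a ∈ Finset.Icc 1 X, (a.divisors.card : ℝ) * Nat.gcd (h / g) a ≤ K ^ 2 * N := by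
    have hhg : h / g ≠ 0 := (Nat.div_pos (Nat.le_of_dvd (Nat.pos_of_ne_zero hh) hg) hg0).ne'
    calc _ ≤ ∑ a ∈ Finset.Icc 1 X, K * (Nat.gcd (h / g) a : ℝ) := by
          refine Finset.sum_le_sum fun a ha => ?_
          rw [Finset.mem_Icc] at ha
          exact mul_le_mul_of_nonneg_right (hK a (by omega) (by omega)) (Nat.cast_nonneg _)
      _ ≤ K * ((h / g).divisors.card * X) := by
          rw [← Finset.mul_sum]
          gcongr
          exact sum_gcd_le hhg X
      _ ≤ K * (K * N) := by
          gcongr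
          exact hK _ hhg ((Nat.div_le_self h g).trans hhN)
      _ = _ := by ring
  have m2 : |(N : ℝ) * (2 * ∑ a ∈ Finset.Icc 1 X, (a.totient : ℝ) / a - X)
      - (2 / (riemannZeta 2).re - 1) * (1 / g) * (N : ℝ) ^ 2| ≤ N * (2 * (H + 1) + B) := by
    have e : (N : ℝ) * (2 * ∑ a ∈ Finset.Icc 1 X, (a.totient : ℝ) / a - X)
        - (2 / (riemannZeta 2).re - 1) * (1 / g) * (N : ℝ) ^ 2
        = N * (2 * (∑ a ∈ Finset.Icc 1 X, (a.totient : ℝ) / a - X / (riemannZeta 2).re)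
          + (2 / (riemannZeta 2).re - 1) * (X - (N : ℝ) / g)) := by
      ring
    rw [e, abs_mul, abs_of_nonneg (by linarith : (0 : ℝ) ≤ N)]
    refine mul_le_mul_of_nonneg_left ?_ (by linarith)
    refine (abs_add_le _ _).trans (add_le_add ?_ ?_)
    · rw [abs_mul, abs_two]
      have := abs_sum_totient_div_sub_le X
      linarith
    · rw [abs_mul]
      calc B * |(X : ℝ) - (N : ℝ) / g| ≤ B * 1 := by gcongr
        _ = B := mul_one _
  refine (abs_sub_le _ _ _).trans ((add_le_add m1 m2).trans ?_)
  have hK2 : 1 ≤ K ^ 2 := one_le_pow₀ hK1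
  have hH2 : 1 ≤ H ^ 2 := one_le_pow₀ hH1
  set W := K ^ 2 * H ^ 2 with hW
  have w1 : H ^ 2 ≤ W := le_mul_of_one_le_left (by positivity) hK2
  have w2 : K ^ 2 ≤ W := le_mul_of_one_le_right (by positivity) hH2
  have w3 : 1 ≤ W := hK2.trans w2
  have w4 : H ≤ W := (le_self_pow₀ hH1 two_ne_zero).trans w1
  have c0 : 0 ≤ (N : ℝ) + D := by linarith
  have c1 : (D + N) * H ^ 2 ≤ W * (N + D) := by
    rw [mul_comm, add_comm D]
    exact mul_le_mul_of_nonneg_right w1 c0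
  have c2 : 2 * D + 3 * N ≤ 3 * (W * (N + D)) := by
    have := le_mul_of_one_le_left c0 w3
    linarith
  have c3 : K ^ 2 * N ≤ W * (N + D) :=
    mul_le_mul w2 (by linarith) (by linarith) (by linarith)
  have c4 : (N : ℝ) * (2 * (H + 1) + B) ≤ (4 + B) * (W * (N + D)) := by
    have : 2 * (H + 1) + B ≤ (4 + B) * W := by
      have := le_mul_of_one_le_right hB0 w3
      linarith
    calc (N : ℝ) * (2 * (H + 1) + B) ≤ (N + D) * ((4 + B) * W) := by
          apply mul_le_mul <;> first | positivity | linarith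
      _ = _ := by ring
  calc _ ≤ W * (N + D) + 3 * (W * (N + D)) + W * (N + D) + (4 + B) * (W * (N + D)) := by linarith
    _ = _ := by ring

theorem abs_solutionCount_sub_main_le {h N : ℕ} (hN : 1 ≤ N) (hh : h ≠ 0)
    (hhN : h ≤ 2 * N ^ 2) {K : ℝ}
    (hK : ∀ n : ℕ, n ≠ 0 → n ≤ 2 * N ^ 2 → (n.divisors.card : ℝ) ≤ K) :
    |(solutionCount h N : ℝ)
        - (8 / (riemannZeta 2).re - 4) * (∑ d ∈ Nat.divisors h, (1 : ℝ) / (d : ℝ)) * (N : ℝ) ^ 2|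
      ≤ (56 + 4 * |2 / (riemannZeta 2).re - 1|) * (K ^ 3 * ((harmonic N : ℚ) : ℝ) ^ 2)
        * (N + |(h : ℝ) - N ^ 2|) := by
  set H : ℝ := ((harmonic N : ℚ) : ℝ) with hH
  set D : ℝ := |(h : ℝ) - N ^ 2| with hD
  set B : ℝ := |2 / (riemannZeta 2).re - 1| with hB
  have hN1 : (1 : ℝ) ≤ N := by exact_mod_cast hN
  have hK1 : 1 ≤ K := by
    have := hK 1 one_ne_zero (by nlinarith)
    simpa using this
  have hH1 : 1 ≤ H := one_le_harmonic hN
  have hD0 : 0 ≤ D := abs_nonneg _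
  have hB0 : 0 ≤ B := abs_nonneg _
  have m1 := abs_solutionCount_sub_le hh hhN hK
  have m2 : |4 * ∑ p ∈ Finset.Icc 1 N ×ˢ Finset.Icc 1 N, (lineCount h N p.1 p.2 : ℝ)
      - (8 / (riemannZeta 2).re - 4) * (∑ d ∈ Nat.divisors h, (1 : ℝ) / (d : ℝ)) * (N : ℝ) ^ 2|
      ≤ 4 * (K * ((9 + B) * (K ^ 2 * H ^ 2) * (N + D))) := by
    have e : 4 * ∑ p ∈ Finset.Icc 1 N ×ˢ Finset.Icc 1 N, (lineCount h N p.1 p.2 : ℝ)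
        - (8 / (riemannZeta 2).re - 4) * (∑ d ∈ Nat.divisors h, (1 : ℝ) / (d : ℝ)) * (N : ℝ) ^ 2
        = 4 * ∑ g ∈ h.divisors, (∑ p ∈ coprimePairs (N / g), (lineCount (h / g) N p.1 p.2 : ℝ)
          - (2 / (riemannZeta 2).re - 1) * (1 / g) * (N : ℝ) ^ 2) := by
      rw [sum_lineCount_eq_sum_divisors hh, Finset.sum_sub_distrib, ← Finset.sum_mul,
        ← Finset.mul_sum]
      ring
    rw [e, abs_mul, abs_of_pos (by norm_num : (0 : ℝ) < 4)]
    refine mul_le_mul_of_nonneg_left ?_ (by norm_num)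
    refine (Finset.abs_sum_le_sum_abs _ _).trans ((Finset.sum_le_sum fun g hg =>
      abs_sum_coprimePairs_div_sub_le hN hh hhN (Nat.dvd_of_mem_divisors hg) hK).trans ?_)
    rw [Finset.sum_const, nsmul_eq_mul]
    exact mul_le_mul_of_nonneg_right (hK h hh hhN) (by positivity)
  refine (abs_sub_le _ _ _).trans ((add_le_add m1 m2).trans ?_)
  have hH2 : 1 ≤ H ^ 2 := one_le_pow₀ hH1
  set W := K ^ 3 * H ^ 2 with hW
  have w0 : K ^ 2 ≤ K ^ 3 := pow_le_pow_right₀ hK1 (by norm_num)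
  have w1 : K ^ 3 ≤ W := le_mul_of_one_le_right (by positivity) hH2
  have w2 : K ≤ W := (le_self_pow₀ hK1 three_ne_zero).trans w1
  have c1 : K * (2 * N + 1) ≤ 3 * (W * N) := by
    calc K * (2 * N + 1) ≤ W * (3 * N) := by
          apply mul_le_mul <;> first | positivity | linarith
      _ = _ := by ring
  have c2 : D * K ^ 2 ≤ W * D := by
    rw [mul_comm]
    exact mul_le_mul_of_nonneg_right (w0.trans w1) hD0
  have c3 : 0 ≤ W * N := by positivity
  have c4 : 0 ≤ W * D := by positivity
  have c5 : 4 * (K * ((9 + B) * (K ^ 2 * H ^ 2) * (N + D))) = (36 + 4 * B) * W * (N + D) := by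
    rw [hW]
    ring
  rw [c5]
  linarith

theorem theorem1p3 (ε : ℝ) (hε : 0 < ε) :
    ∃ C : ℝ, 0 < C ∧ ∀ h N : ℕ, 1 ≤ h → h ≤ 2 * N ^ 2 →
      |(solutionCount h N : ℝ)
          - (8 / (riemannZeta 2).re - 4) * (∑ d ∈ Nat.divisors h, (1 : ℝ) / (d : ℝ)) * (N : ℝ) ^ 2|
        ≤ C * ((N : ℝ) ^ (1 + ε) + (N : ℝ) ^ ε * |(h : ℝ) - (N : ℝ) ^ 2|) := by
  -- the error is `K³ H² (N + |Δ|)` with `K ≪ (2 N²)^δ` and `H ≪ N^δ`, so `N^(8 δ)` is lost in total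
  set δ : ℝ := ε / 8 with hδ
  have hδ0 : 0 < δ := by positivity
  obtain ⟨C₁, hC₁, hdiv⟩ := exists_card_divisors_le_rpow hδ0
  obtain ⟨C₂, hC₂, hharm⟩ := exists_harmonic_le_rpow hδ0
  set B : ℝ := |2 / (riemannZeta 2).re - 1| with hB
  have hB0 : 0 ≤ B := abs_nonneg _
  refine ⟨(56 + 4 * B) * ((C₁ * 2 ^ δ) ^ 3 * C₂ ^ 2), by positivity, fun h N hh hhN => ?_⟩
  have hN : 1 ≤ N := by
    by_contra hcon
    have : N = 0 := by omega
    subst this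
    simp at hhN
    omega
  have hNpos : (0 : ℝ) < N := by exact_mod_cast hN
  set P : ℝ := (N : ℝ) ^ δ with hP
  have hP0 : 0 < P := Real.rpow_pos_of_pos hNpos _
  set K : ℝ := C₁ * 2 ^ δ * P ^ 2 with hKdef
  have hK : ∀ n : ℕ, n ≠ 0 → n ≤ 2 * N ^ 2 → (n.divisors.card : ℝ) ≤ K := by
    intro n hn hnN
    refine (hdiv n hn).trans ?_
    have h1 : (n : ℝ) ^ δ ≤ (2 * (N : ℝ) ^ 2) ^ δ :=
      Real.rpow_le_rpow (by positivity) (by exact_mod_cast hnN) hδ0.le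
    have h2 : (2 * (N : ℝ) ^ 2) ^ δ = 2 ^ δ * P ^ 2 := by
      rw [Real.mul_rpow (by norm_num) (by positivity), hP, ← Real.rpow_natCast, ← Real.rpow_natCast,
        ← Real.rpow_mul hNpos.le, ← Real.rpow_mul hNpos.le, mul_comm δ]
    rw [hKdef, mul_assoc, ← h2]
    gcongr
  refine (abs_solutionCount_sub_main_le hN (by omega) hhN hK).trans ?_
  have hP8 : P ^ 8 = (N : ℝ) ^ ε := by
    rw [hP, ← Real.rpow_natCast, ← Real.rpow_mul hNpos.le]
    congr 1
    rw [hδ]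
    push_cast
    ring
  have hPN : (N : ℝ) ^ (1 + ε) = N * P ^ 8 := by
    rw [hP8, Real.rpow_add hNpos, Real.rpow_one]
  rw [hPN, ← hP8]
  have hH0 : (0 : ℝ) ≤ ((harmonic N : ℚ) : ℝ) := zero_le_one.trans (one_le_harmonic hN)
  calc _ ≤ (56 + 4 * B) * (K ^ 3 * (C₂ * P) ^ 2) * (N + |(h : ℝ) - (N : ℝ) ^ 2|) := by
        gcongr
        exact hharm N hN
    _ = _ := by
        rw [hKdef]
        ring
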